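/- Let $M$ be a complex two-dimensional locally symmetric Kähler manifold (that is, $\nabla R=0$), let $U\subset M$ be an open subset of the domain of a holomorphic chart $(z^1,z^2)$, and let $g_{k\bar l}=g_{\bar lk}$ be the components of the Kähler metric in this chart, with inverse $g^{\bar kl}=g^{l\bar k}$. Put $D^k=g^{k\bar l}\partial_{\bar l}$ and $D^{\bar k}=g^{\bar kl}\partial_l$ (repeated indices are summed). Let $$R_{\bar i}{}^{\bar k\bar l}{}_{\bar c}=g^{\bar kp}g^{\bar lq}R_{\bar ipq\bar c},\qquad R_{ABCD}=g_{DE}R_{ABC}{}^{E},\qquad R(\partial_A,\partial_B)\partial_C=R_{ABC}{}^{D}\partial_D .$$ Let $f\ast g=\sum_{k\ge0}C_k(f,g)\hbar^k$ be a star product on $U$: an associative $\mathbb C[[\hbar]]$-bilinear product on $C^\infty(U)[[\hbar]]$ with unit $1$, where the $C_k$ are bidifferential operators, $C_0(f,g)=fg$, and $C_1(f,g)-C_1(g,f)=\{f,g\}=g^{\bar lm}(\partial_{\bar l}f\,\partial_mg-\partial_mf\,\partial_{\bar l}g)$. Suppose that it is the star product with separation of variables belonging to the Kähler form, in the following sense.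 On all open subsets of $U$ one has $a\ast f=af$ for holomorphic $a$ and $f\ast b=fb$ for anti-holomorphic $b$. Moreover, near every point of $U$ there is a Kähler potential $\Phi$ (so $g_{k\bar l}=\partial_k\partial_{\bar l}\Phi$) such that every left multiplication operator $L_f\colon g\mapsto f\ast g$ commutes with $\partial_{\bar l}\Phi+\hbar\,\partial_{\bar l}$ for $l=1,2$. Suppose also that $$f\ast g=\sum_{n=0}^\infty\sum_{i,j=1}^{n+1}T^n_{ij}\,\{(D^1)^{n-i+1}(D^2)^{i-1}f\}\,\{(D^{\bar1})^{n-j+1}(D^{\bar2})^{j-1}g\}$$ with coefficients $T^n_{ij}\in C^\infty(U)[[\hbar]]$, where for each power of $\hbar$ only finitely many $n$ contribute. Put $T^n_{ij}=0$ if $i$ or $j$ is not in $\{1,\dots,n+1\}$, and $T^{-1}=0$. Then for every $n\ge0$ and at every point of $U$, the $(n+1)\times(n+1)$ matrices over $\mathbb C[[\hbar]]$ $$T_n=(T^n_{ij}),\qquad A'_n=\Bigl(\sum_{k,l=1}^2g_{\bar kl}\,T^{n-1}_{i-\delta_{2l},\,j-\delta_{2k}}\Bigr)_{i,j}$$ satisfy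 $$T_nX_n=\hbar A'_n .$$ Here $X_n=(X^n_{ij})$ is the pentadiagonal matrix with $$\begin{aligned} X^n_{j-2,j}&=\tbinom{n-j+3}2\hbar R_{\bar2}{}^{\bar1\bar1}{}_{\bar2},\\ X^n_{j-1,j}&=2\tbinom{n-j+2}2\hbar R_{\bar2}{}^{\bar1\bar1}{}_{\bar1}+(n-j+2)(j-2)\hbar R_{\bar2}{}^{\bar2\bar1}{}_{\bar2},\\ X^n_{j,j}&=n+\tbinom{n-j+1}2\hbar R_{\bar1}{}^{\bar1\bar1}{}_{\bar1}+\tbinom{j-1}2\hbar R_{\bar2}{}^{\bar2\bar2}{}_{\bar2}+2(n-j+1)(j-1)\hbar R_{\bar2}{}^{\bar2\bar1}{}_{\bar1},\\ X^n_{j+1,j}&=2\tbinom j2\hbar R_{\bar2}{}^{\bar2\bar2}{}_{\bar1}+j(n-j)\hbar R_{\bar1}{}^{\bar2\bar1}{}_{\bar1},\\ X^n_{j+2,j}&=\tbinom{j+1}2\hbar R_{\bar1}{}^{\bar2\bar2}{}_{\bar1}, \end{aligned}$$ and $X^n_{jk}=0$ for $|j-k|>2$. -/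

import Mathlib

open scoped Manifold ContDiff PowerSeries

namespace KahlerStar

/-! ### Calculus in two complex coordinates -/

/-- The coordinate space `ℂ²`; the index `0 : Fin 2` stands for `1` and `1 : Fin 2` for `2`. -/
abbrev C2 : Type := Fin 2 → ℂ

/-- The indices `1, 2, 1̄, 2̄`: `Sum.inl k` is the index `k` and `Sum.inr k` is `k̄`. -/
abbrev CIdx : Type := Fin 2 ⊕ Fin 2

/-- The complex partial derivatives `∂_k = (∂_{x^k} - i ∂_{y^k}) / 2` and
`∂_k̄ = (∂_{x^k} + i ∂_{y^k}) / 2`, where `z^k = x^k + i y^k`. -/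
noncomputable def pd (A : CIdx) (f : C2 → ℂ) (z : C2) : ℂ :=
  match A with
  | Sum.inl k => (fderiv ℝ f z (Pi.single k 1)
      - Complex.I * fderiv ℝ f z (Pi.single k Complex.I)) / 2
  | Sum.inr k => (fderiv ℝ f z (Pi.single k 1)
      + Complex.I * fderiv ℝ f z (Pi.single k Complex.I)) / 2

/-- `∂^I = (∂_1)^{I_1} (∂_2)^{I_2} (∂_1̄)^{I_1̄} (∂_2̄)^{I_2̄}` for a multi-index `I`. -/
noncomputable def pdMulti (I : CIdx → ℕ) (f : C2 → ℂ) : C2 → ℂ :=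
  (pd (Sum.inl 0))^[I (Sum.inl 0)] ((pd (Sum.inl 1))^[I (Sum.inl 1)]
    ((pd (Sum.inr 0))^[I (Sum.inr 0)] ((pd (Sum.inr 1))^[I (Sum.inr 1)] f)))

/-! ### Levi-Civita connection and curvature of a Hermitian metric in coordinates

The metric is given by its components `G z k l = g_{k l̄}(z)`. -/

/-- The components `g_{AB}` of the complexified metric: `g_{kl} = g_{k̄l̄} = 0` and
`g_{k l̄} = g_{l̄ k}`. -/
def gLow (G : C2 → Matrix (Fin 2) (Fin 2) ℂ) (z : C2) : Matrix CIdx CIdx ℂ :=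
  Matrix.fromBlocks 0 (G z) (G z).transpose 0

/-- The components `g^{AB}` of the inverse matrix. -/
noncomputable def gUp (G : C2 → Matrix (Fin 2) (Fin 2) ℂ) (z : C2) : Matrix CIdx CIdx ℂ :=
  (gLow G z)⁻¹

/-- The Christoffel symbol `Γ^A_{BC}`. -/
noncomputable def christoffel (G : C2 → Matrix (Fin 2) (Fin 2) ℂ) (A B C : CIdx) (z : C2) : ℂ :=
  (1 / 2) * ∑ D : CIdx, gUp G z A D *
    (pd B (fun w => gLow G w D C) z + pd C (fun w => gLow G w D B) z
      - pd D (fun w => gLow G w B C) z)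

/-- The components `R_{ABC}{}^D` of the Riemann tensor, `R(∂_A, ∂_B) ∂_C = R_{ABC}{}^D ∂_D`. -/
noncomputable def riem (G : C2 → Matrix (Fin 2) (Fin 2) ℂ) (A B C D : CIdx) (z : C2) : ℂ :=
  pd A (christoffel G D B C) z - pd B (christoffel G D A C) z
    + ∑ E : CIdx, (christoffel G E B C z * christoffel G D A E z
      - christoffel G E A C z * christoffel G D B E z)

/-- `R_{ABCD} = g_{DE} R_{ABC}{}^E`. -/
noncomputable def riemLow (G : C2 → Matrix (Fin 2) (Fin 2) ℂ) (A B C D : CIdx) (z : C2) : ℂ :=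
  ∑ E : CIdx, gLow G z D E * riem G A B C E z

/-- The components `∇_E R_{ABC}{}^D` of the covariant derivative of the Riemann tensor. -/
noncomputable def covRiem (G : C2 → Matrix (Fin 2) (Fin 2) ℂ) (E A B C D : CIdx) (z : C2) : ℂ :=
  pd E (riem G A B C D) z
    + ∑ F : CIdx, (christoffel G D E F z * riem G A B C F z
      - christoffel G F E A z * riem G F B C D z
      - christoffel G F E B z * riem G A F C D z
      - christoffel G F E C z * riem G A B F D z)

/-- `curv G z i k l c` is `R_{ī}{}^{k̄ l̄}{}_{c̄} = g^{k̄ p} g^{l̄ q} R_{ī p q c̄}` at `z`. -/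
noncomputable def curv (G : C2 → Matrix (Fin 2) (Fin 2) ℂ) (z : C2) (i k l c : Fin 2) : ℂ :=
  ∑ p : Fin 2, ∑ q : Fin 2, gUp G z (Sum.inr k) (Sum.inl p) * gUp G z (Sum.inr l) (Sum.inl q) *
    riemLow G (Sum.inr i) (Sum.inl p) (Sum.inl q) (Sum.inr c) z

/-- `D^k = g^{k l̄} ∂_l̄`. -/
noncomputable def dUp (G : C2 → Matrix (Fin 2) (Fin 2) ℂ) (k : Fin 2) (f : C2 → ℂ) (z : C2) : ℂ :=
  ∑ l : Fin 2, gUp G z (Sum.inl k) (Sum.inr l) * pd (Sum.inr l) f z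

/-- `D^k̄ = g^{k̄ l} ∂_l`. -/
noncomputable def dUpBar (G : C2 → Matrix (Fin 2) (Fin 2) ℂ) (k : Fin 2) (f : C2 → ℂ)
    (z : C2) : ℂ :=
  ∑ l : Fin 2, gUp G z (Sum.inr k) (Sum.inl l) * pd (Sum.inl l) f z

/-! ### Kähler surfaces -/

/-- A Hermitian inner product `h_p(v, w)` on each holomorphic tangent space of a complex surface
(linear in `v`, conjugate-linear in `w`), not yet assumed to be smooth. -/
structure HermitianForm (M : Type*) [TopologicalSpace M] [ChartedSpace C2 M] where
  inner : ∀ p : M, TangentSpace 𝓘(ℂ, C2) p →ₗ[ℂ] TangentSpace 𝓘(ℂ, C2) p →ₗ⋆[ℂ] ℂ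
  conj_symm : ∀ p v w, inner p v w = (starRingEnd ℂ) (inner p w v)
  pos : ∀ p v, v ≠ 0 → 0 < (inner p v v).re

/-- The components `g_{k l̄}` in holomorphic coordinates `φ`, as functions on `φ.target`. -/
noncomputable def HermitianForm.comp {M : Type*} [TopologicalSpace M] [ChartedSpace C2 M]
    (h : HermitianForm M) (φ : OpenPartialHomeomorph M C2) (z : C2) : Matrix (Fin 2) (Fin 2) ℂ :=
  Matrix.of fun k l =>
    h.inner (φ.symm z)
      (mfderiv 𝓘(ℂ, C2) 𝓘(ℂ, C2) φ.symm z (Pi.single k (1 : ℂ) : C2))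
      (mfderiv 𝓘(ℂ, C2) 𝓘(ℂ, C2) φ.symm z (Pi.single l (1 : ℂ) : C2))

/-- `h` is a Kähler metric: it is smooth, and its fundamental form `i g_{k l̄} dz^k ∧ dz̄^l` is
closed, that is, `∂_i g_{j k̄} = ∂_j g_{i k̄}` and `∂_ī g_{j k̄} = ∂_k̄ g_{j ī}`, in all
holomorphic charts. -/
structure HermitianForm.IsKahler {M : Type*} [TopologicalSpace M] [ChartedSpace C2 M]
    (h : HermitianForm M) : Prop where
  smooth : ∀ φ ∈ IsManifold.maximalAtlas 𝓘(ℂ, C2) ω M, ∀ k l : Fin 2,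
    ContDiffOn ℝ ∞ (fun z => h.comp φ z k l) φ.target
  closed : ∀ φ ∈ IsManifold.maximalAtlas 𝓘(ℂ, C2) ω M, ∀ z ∈ φ.target, ∀ i j k : Fin 2,
    pd (Sum.inl i) (fun w => h.comp φ w j k) z = pd (Sum.inl j) (fun w => h.comp φ w i k) z ∧
    pd (Sum.inr i) (fun w => h.comp φ w j k) z = pd (Sum.inr k) (fun w => h.comp φ w j i) z

/-- The metric is locally symmetric: `∇ R = 0`. -/
def HermitianForm.IsLocallySymmetric {M : Type*} [TopologicalSpace M] [ChartedSpace C2 M]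
    (h : HermitianForm M) : Prop :=
  ∀ φ ∈ IsManifold.maximalAtlas 𝓘(ℂ, C2) ω M, ∀ z ∈ φ.target, ∀ A B C D E : CIdx,
    covRiem (h.comp φ) E A B C D z = 0

/-! ### Star products on an open set `Ω` of the coordinate space

A formal function is a map `F : C2 → ℂ⟦X⟧`, the variable `X` being the formal parameter `ħ`.
Operators act on total functions; all conditions concern only functions which are smooth on an
open set `V ⊆ Ω`, and their values at the points of `V`. -/

/-- `F ∈ C^∞(V)[[ħ]]`. -/
def SmoothOn (V : Set C2) (F : C2 → ℂ⟦X⟧) : Prop :=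
  ∀ k : ℕ, ContDiffOn ℝ ∞ (fun z => PowerSeries.coeff k (F z)) V

/-- A function as a formal function that is constant in `ħ`. -/
noncomputable def lift (f : C2 → ℂ) : C2 → ℂ⟦X⟧ := fun z => PowerSeries.C (f z)

/-- `∂_A` on formal functions, coefficient by coefficient. -/
noncomputable def pdF (A : CIdx) (F : C2 → ℂ⟦X⟧) : C2 → ℂ⟦X⟧ :=
  fun z => PowerSeries.mk fun k => pd A (fun w => PowerSeries.coeff k (F w)) z

/-- The product `f ∗ g = ∑_k C_k(f, g) ħ^k`, extended `ħ`-bilinearly to formal functions. -/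
noncomputable def starMul (C : ℕ → (C2 → ℂ) → (C2 → ℂ) → C2 → ℂ) (F G : C2 → ℂ⟦X⟧) : C2 → ℂ⟦X⟧ :=
  fun z => PowerSeries.mk fun m =>
    ∑ p ∈ Finset.HasAntidiagonal.antidiagonal m, ∑ q ∈ Finset.HasAntidiagonal.antidiagonal p.2,
      C p.1 (fun w => PowerSeries.coeff q.1 (F w)) (fun w => PowerSeries.coeff q.2 (G w)) z

/-- `B` is a bidifferential operator `B(f, g) = ∑_{I,J} a_{I,J} ∂^I f ∂^J g` on `Ω`. -/
def IsBidifferential (Ω : Set C2) (B : (C2 → ℂ) → (C2 → ℂ) → C2 → ℂ) : Prop :=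
  ∃ (S : Finset ((CIdx → ℕ) × (CIdx → ℕ))) (a : (CIdx → ℕ) × (CIdx → ℕ) → C2 → ℂ),
    (∀ s ∈ S, ContDiffOn ℝ ∞ (a s) Ω) ∧
    ∀ V : Set C2, IsOpen V → V ⊆ Ω → ∀ f g : C2 → ℂ,
      ContDiffOn ℝ ∞ f V → ContDiffOn ℝ ∞ g V → ∀ z ∈ V,
        B f g z = ∑ s ∈ S, a s z * pdMulti s.1 f z * pdMulti s.2 g z

/-- The Poisson bracket `{f, g} = g^{l̄ m} (∂_l̄ f ∂_m g - ∂_m f ∂_l̄ g)` of the Kähler metric. -/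
noncomputable def poisson (G : C2 → Matrix (Fin 2) (Fin 2) ℂ) (f g : C2 → ℂ) (z : C2) : ℂ :=
  ∑ l : Fin 2, ∑ m : Fin 2, gUp G z (Sum.inr l) (Sum.inl m) *
    (pd (Sum.inr l) f z * pd (Sum.inl m) g z - pd (Sum.inl m) f z * pd (Sum.inr l) g z)

/-- `f ∗ g = ∑_k C_k(f, g) ħ^k` is a star product on `Ω`. -/
structure IsStarProduct (G : C2 → Matrix (Fin 2) (Fin 2) ℂ) (Ω : Set C2)
    (C : ℕ → (C2 → ℂ) → (C2 → ℂ) → C2 → ℂ) : Prop where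
  assoc : ∀ V : Set C2, IsOpen V → V ⊆ Ω → ∀ F₁ F₂ F₃ : C2 → ℂ⟦X⟧,
    SmoothOn V F₁ → SmoothOn V F₂ → SmoothOn V F₃ → ∀ z ∈ V,
      starMul C F₁ (starMul C F₂ F₃) z = starMul C (starMul C F₁ F₂) F₃ z
  bidifferential : ∀ k, IsBidifferential Ω (C k)
  zeroth : ∀ V : Set C2, IsOpen V → V ⊆ Ω → ∀ f g : C2 → ℂ,
    ContDiffOn ℝ ∞ f V → ContDiffOn ℝ ∞ g V → ∀ z ∈ V, C 0 f g z = f z * g z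
  first : ∀ V : Set C2, IsOpen V → V ⊆ Ω → ∀ f g : C2 → ℂ,
    ContDiffOn ℝ ∞ f V → ContDiffOn ℝ ∞ g V → ∀ z ∈ V,
      C 1 f g z - C 1 g f z = poisson G f g z
  unit : ∀ V : Set C2, IsOpen V → V ⊆ Ω → ∀ F : C2 → ℂ⟦X⟧, SmoothOn V F → ∀ z ∈ V,
    starMul C F 1 z = F z ∧ starMul C 1 F z = F z

/-- Separation of variables: `a ∗ f = a f` for holomorphic `a`, and `f ∗ b = f b` for
anti-holomorphic `b`. -/
def SeparatesVariables (Ω : Set C2) (C : ℕ → (C2 → ℂ) → (C2 → ℂ) → C2 → ℂ) : Prop :=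
  ∀ V : Set C2, IsOpen V → V ⊆ Ω → ∀ f : C2 → ℂ, ContDiffOn ℝ ∞ f V →
    (∀ a : C2 → ℂ, DifferentiableOn ℂ a V →
      ∀ z ∈ V, starMul C (lift a) (lift f) z = lift (fun w => a w * f w) z) ∧
    (∀ b : C2 → ℂ, DifferentiableOn ℂ (fun w => (starRingEnd ℂ) (b w)) V →
      ∀ z ∈ V, starMul C (lift f) (lift b) z = lift (fun w => f w * b w) z)

/-- `Φ` is a Kähler potential on `V`: a smooth real function with `g_{k l̄} = ∂_k ∂_l̄ Φ`. -/
def IsKahlerPotential (G : C2 → Matrix (Fin 2) (Fin 2) ℂ) (V : Set C2) (Φ : C2 → ℝ) : Prop :=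
  ContDiffOn ℝ ∞ Φ V ∧ ∀ z ∈ V, ∀ k l : Fin 2,
    G z k l = pd (Sum.inl k) (pd (Sum.inr l) (fun w => (Φ w : ℂ))) z

/-- The operator `R_{∂_l̄ Φ} = ∂_l̄ Φ + ħ ∂_l̄`. -/
noncomputable def rightOp (Φ : C2 → ℝ) (l : Fin 2) (F : C2 → ℂ⟦X⟧) : C2 → ℂ⟦X⟧ :=
  fun z => PowerSeries.C (pd (Sum.inr l) (fun w => (Φ w : ℂ)) z) * F z
    + PowerSeries.X * pdF (Sum.inr l) F z

/-- Karabegov's condition `[L_f, R_{∂_l̄ Φ}] = 0`, where `L_f g = f ∗ g` and `Φ` is a local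
Kähler potential of the metric. It says that the star product is the one with separation of
variables that belongs to the Kähler form itself. -/
def KarabegovCondition (G : C2 → Matrix (Fin 2) (Fin 2) ℂ) (Ω : Set C2)
    (C : ℕ → (C2 → ℂ) → (C2 → ℂ) → C2 → ℂ) : Prop :=
  ∀ z₀ ∈ Ω, ∃ V₀ : Set C2, IsOpen V₀ ∧ z₀ ∈ V₀ ∧ V₀ ⊆ Ω ∧
    ∃ Φ : C2 → ℝ, IsKahlerPotential G V₀ Φ ∧
      ∀ V : Set C2, IsOpen V → V ⊆ V₀ → ∀ F H : C2 → ℂ⟦X⟧, SmoothOn V F → SmoothOn V H →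
        ∀ l : Fin 2, ∀ z ∈ V, starMul C F (rightOp Φ l H) z = rightOp Φ l (starMul C F H) z

/-- The star product has the form
`f ∗ g = ∑_n ∑_{i,j=1}^{n+1} T^n_{ij} {(D^1)^{n-i+1} (D^2)^{i-1} f} {(D^1̄)^{n-j+1} (D^2̄)^{j-1} g}`
with smooth coefficients `T^n_{ij} ∈ C^∞(Ω)[[ħ]]`. The matrix entry `T n z i j` with `i, j` counted
from `0` is the entry with the indices `i + 1, j + 1` counted from `1`. At each order in `ħ` only
finitely many `n` contribute. -/
def HasExpansion (G : C2 → Matrix (Fin 2) (Fin 2) ℂ) (Ω : Set C2)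
    (C : ℕ → (C2 → ℂ) → (C2 → ℂ) → C2 → ℂ)
    (T : ∀ n : ℕ, C2 → Matrix (Fin (n + 1)) (Fin (n + 1)) ℂ⟦X⟧) : Prop :=
  (∀ n i j, SmoothOn Ω (fun z => T n z i j)) ∧
  ∀ r : ℕ, ∃ N : ℕ,
    (∀ n, N ≤ n → ∀ i j, ∀ z ∈ Ω, PowerSeries.coeff r (T n z i j) = 0) ∧
    ∀ V : Set C2, IsOpen V → V ⊆ Ω → ∀ f g : C2 → ℂ,
      ContDiffOn ℝ ∞ f V → ContDiffOn ℝ ∞ g V → ∀ z ∈ V,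
        C r f g z = ∑ n ∈ Finset.range N, ∑ i : Fin (n + 1), ∑ j : Fin (n + 1),
          PowerSeries.coeff r (T n z i j) *
            (dUp G 0)^[n - i] ((dUp G 1)^[i] f) z *
            (dUpBar G 0)^[n - j] ((dUpBar G 1)^[j] g) z

/-! ### The matrices of the theorem -/

/-- The `(i, j)` entry of `A`, with `i, j` counted from `1`, and `0` outside the matrix. -/
def entry {m : ℕ} (A : Matrix (Fin m) (Fin m) ℂ⟦X⟧) (i j : ℤ) : ℂ⟦X⟧ :=
  if h : (1 ≤ i ∧ i ≤ m) ∧ (1 ≤ j ∧ j ≤ m) then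
    A ⟨(i - 1).toNat, by omega⟩ ⟨(j - 1).toNat, by omega⟩
  else 0

/-- `A'_n = (∑_{k,l} g_{k̄ l} T^{n-1}_{i - δ_{2l}, j - δ_{2k}})`, where `T^{-1} = 0`. Here
`G z l k = g_{l k̄} = g_{k̄ l}`, and `δ_{2l}` is `1` exactly if `l` is `1 : Fin 2`. -/
noncomputable def matA (G : C2 → Matrix (Fin 2) (Fin 2) ℂ)
    (T : ∀ n : ℕ, C2 → Matrix (Fin (n + 1)) (Fin (n + 1)) ℂ⟦X⟧) (z : C2) :
    ∀ n : ℕ, Matrix (Fin (n + 1)) (Fin (n + 1)) ℂ⟦X⟧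
  | 0 => 0
  | n + 1 => Matrix.of fun a b =>
      let i : ℤ := (a : ℕ) + 1
      let j : ℤ := (b : ℕ) + 1
      ∑ k : Fin 2, ∑ l : Fin 2, PowerSeries.C (G z l k) *
        entry (T n z) (i - if l = 1 then 1 else 0) (j - if k = 1 then 1 else 0)

/-- The pentadiagonal matrix `X_n`, with `R i k l c = R_{ī}{}^{k̄ l̄}{}_{c̄}`. The row `i` and the
column `j` are counted from `1`; no subtraction of natural numbers below is truncated. -/
noncomputable def matX (R : Fin 2 → Fin 2 → Fin 2 → Fin 2 → ℂ) (n : ℕ) :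
    Matrix (Fin (n + 1)) (Fin (n + 1)) ℂ⟦X⟧ :=
  Matrix.of fun a b =>
    let i : ℕ := a + 1
    let j : ℕ := b + 1
    let ħR : Fin 2 → Fin 2 → Fin 2 → Fin 2 → ℂ⟦X⟧ :=
      fun i k l c => PowerSeries.X * PowerSeries.C (R i k l c)
    if i + 2 = j then ((n + 3 - j).choose 2 : ℕ) * ħR 1 0 0 1
    else if i + 1 = j then
      2 * ((n + 2 - j).choose 2 : ℕ) * ħR 1 0 0 0
        + ((n + 2 - j : ℕ) : ℂ⟦X⟧) * ((j - 2 : ℕ) : ℂ⟦X⟧) * ħR 1 1 0 1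
    else if i = j then
      (n : ℂ⟦X⟧) + ((n + 1 - j).choose 2 : ℕ) * ħR 0 0 0 0 + ((j - 1).choose 2 : ℕ) * ħR 1 1 1 1
        + 2 * ((n + 1 - j : ℕ) : ℂ⟦X⟧) * ((j - 1 : ℕ) : ℂ⟦X⟧) * ħR 1 1 0 0
    else if i = j + 1 then
      2 * (j.choose 2 : ℕ) * ħR 1 1 1 0
        + (j : ℂ⟦X⟧) * ((n - j : ℕ) : ℂ⟦X⟧) * ħR 0 1 0 0
    else if i = j + 2 then ((j + 1).choose 2 : ℕ) * ħR 0 1 1 0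
    else 0

end KahlerStar

open KahlerStar

/-!
The identity `T_n X_n = ħ A'_n` is the condition `[L_f, ∂_l̄ Φ + ħ ∂_l̄] = 0` read off on test
functions that diagonalise the operators `D^k` and `D^k̄`.

Fix a point `z` and a local Kähler potential `Φ`. Since `g_{k l̄} = ∂_k ∂_l̄ Φ`, the functions
`u_m = ∂_m Φ` and `v_m = ∂_m̄ Φ`, normalised by constants to vanish at `z`, satisfy
`D^k u_m = δ_{km}` and `D^k̄ v_m = δ_{km}` (`isDual_raise`, `isDual_raiseBar`). Hence `D^k` and
`D^k̄` act on polynomials in `u` and in `v` as partial derivatives, and the divided monomials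
`u^α / α!` and `v^β / β!` are dual to the iterated derivatives at `z`. Put `f = u^α / α!` and
`g = v^β / β!` with `|α| = |β| + 1 = n`. The condition at `z` reads
`f ∗ (v_l g) + ħ f ∗ ∂_l̄ g = ħ ∂_l̄ (f ∗ g)`, and its three terms are as follows
(`coeff_recursion`).

* `f ∗ (v_l g)` is `(β_l + 1) T_{α, β + e_l}`.
* In `f ∗ ∂_l̄ g = ∑_{β'} T_{α β'} D̄^{β'} ∂_l̄ g` one has `|β'| = |β| + 1` and
  `∂_l̄ g = ∑_m v^{β - e_m} / (β - e_m)! ∂_l̄ ∂_m̄ Φ`. By the Leibniz rule at `z`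
  (`IsDual.eval_iterate_divMon_mul`) only binomial coefficients times second derivatives
  `D^k̄ D^p̄ ∂_l̄ ∂_m̄ Φ` remain, and these are the curvature components `R_{l̄}{}^{k̄ p̄}{}_{m̄}`
  (`raiseBar_raiseBar_potential`, `LocalKahler.curv_eq_upBar_upBar`).
* In `∂_l̄ (f ∗ g)` the derivative has to fall on a derivative of `f`, because the two factors are
  homogeneous of different degrees while the expansion only contains derivatives of equal order;
  since `∂_l̄ u_m = g_{m l̄}`, the result is `∑_m g_{m l̄} T_{α - e_m, β}`
  (`eval_derivation_expansion_divMon`).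

For a multi-index `γ` with `|γ| = n`, the sum over `l` of these relations with `β = γ - e_l` is the
column `γ` of the matrix identity (`matX_apply`, `matA_succ_apply`, `mul_matX_apply`). Invertibility
of `(g_{k l̄})` comes from positivity of the metric (`isUnit_det_comp`).

The calculations with derivatives take place in the commutative algebra `smoothAlg V` of smooth
functions on an open set, on which the `∂_A` are commuting derivations.
-/

namespace KahlerStar

/-! ### Divided powers in dual coordinates of commuting derivations -/

section DividedPowers

variable {A : Type*} [CommRing A] [Algebra ℂ A]

/-- The divided power `v ^ c / c!`. -/
noncomputable def divPow (v : A) (c : ℕ) : A := ((c.factorial : ℂ)⁻¹) • v ^ c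

@[simp] lemma divPow_zero (v : A) : divPow v 0 = 1 := by simp [divPow]

lemma mul_divPow (v : A) (c : ℕ) : v * divPow v c = ((c : ℂ) + 1) • divPow v (c + 1) := by
  have h1 : ((c.factorial : ℕ) : ℂ) ≠ 0 := by exact_mod_cast c.factorial_ne_zero
  have h2 : (c : ℂ) + 1 ≠ 0 := by exact_mod_cast c.succ_ne_zero
  rw [divPow, divPow, mul_smul_comm, smul_smul, Nat.factorial_succ, pow_succ']
  congr 1
  push_cast
  field_simp

lemma derivation_divPow_succ (D : Derivation ℂ A A) (v : A) (c : ℕ) :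
    D (divPow v (c + 1)) = divPow v c * D v := by
  have h1 : ((c.factorial : ℕ) : ℂ) ≠ 0 := by exact_mod_cast c.factorial_ne_zero
  have h2 : (c : ℂ) + 1 ≠ 0 := by exact_mod_cast c.succ_ne_zero
  rw [divPow, divPow, D.map_smul, D.leibniz_pow, Nat.factorial_succ, ← Nat.cast_smul_eq_nsmul ℂ,
    smul_smul, smul_mul_assoc, smul_eq_mul, Nat.add_sub_cancel]
  congr 1
  push_cast
  field_simp

/-- The divided monomial `v₀ ^ c / c! * v₁ ^ d / d!`. -/
noncomputable def divMon (v : Fin 2 → A) (c d : ℕ) : A := divPow (v 0) c * divPow (v 1) d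

/-- `D 0`, `D 1` act on functions of `v 0`, `v 1` as the partial derivatives. -/
def IsDual (D : Fin 2 → Derivation ℂ A A) (v : Fin 2 → A) : Prop :=
  ∀ i j, D i (v j) = if i = j then 1 else 0

lemma mul_divMon_zero (v : Fin 2 → A) (c d : ℕ) :
    v 0 * divMon v c d = ((c : ℂ) + 1) • divMon v (c + 1) d := by
  rw [divMon, divMon, ← mul_assoc, mul_divPow, smul_mul_assoc]

lemma mul_divMon_one (v : Fin 2 → A) (c d : ℕ) :
    v 1 * divMon v c d = ((d : ℂ) + 1) • divMon v c (d + 1) := by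
  rw [divMon, divMon, mul_left_comm, mul_divPow, mul_smul_comm]

/-- The chain rule for divided monomials. -/
lemma derivation_divMon (D : Derivation ℂ A A) (v : Fin 2 → A) (c d : ℕ) :
    D (divMon v c d) = (if 1 ≤ c then divMon v (c - 1) d * D (v 0) else 0)
      + (if 1 ≤ d then divMon v c (d - 1) * D (v 1) else 0) := by
  rw [divMon, D.leibniz, smul_eq_mul, smul_eq_mul]
  rcases c with _ | c <;> rcases d with _ | d <;>
    (simp [derivation_divPow_succ, divMon]; try ring)

lemma iterate_derivation_smul (D : Derivation ℂ A A) (m : ℕ) (c : ℂ) (f : A) :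
    (D^[m]) (c • f) = c • (D^[m]) f :=
  (Function.Commute.iterate_left (g := fun f => c • f) (fun f => D.map_smul c f) m) f

variable {D : Fin 2 → Derivation ℂ A A} {v : Fin 2 → A}

lemma IsDual.zero_divMon (h : IsDual D v) (c d : ℕ) :
    D 0 (divMon v c d) = if 1 ≤ c then divMon v (c - 1) d else 0 := by
  rw [derivation_divMon, h 0 0, h 0 1]; simp

lemma IsDual.one_divMon (h : IsDual D v) (c d : ℕ) :
    D 1 (divMon v c d) = if 1 ≤ d then divMon v c (d - 1) else 0 := by
  rw [derivation_divMon, h 1 0, h 1 1]; simp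

lemma IsDual.iterate_zero_divMon (h : IsDual D v) (a c d : ℕ) :
    ((D 0)^[a]) (divMon v c d) = if a ≤ c then divMon v (c - a) d else 0 := by
  induction a generalizing c with
  | zero => simp
  | succ a ih =>
    rw [Function.iterate_succ_apply, h.zero_divMon]
    rcases c with _ | c
    · simp
    · simp [ih]

lemma IsDual.iterate_one_divMon (h : IsDual D v) (b c d : ℕ) :
    ((D 1)^[b]) (divMon v c d) = if b ≤ d then divMon v c (d - b) else 0 := by
  induction b generalizing d with
  | zero => simp
  | succ a ih =>
    rw [Function.iterate_succ_apply, h.one_divMon]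
    rcases d with _ | d
    · simp
    · simp [ih]

lemma IsDual.iterate_divMon (h : IsDual D v) (a b c d : ℕ) :
    ((D 0)^[a]) (((D 1)^[b]) (divMon v c d))
      = if a ≤ c ∧ b ≤ d then divMon v (c - a) (d - b) else 0 := by
  rw [h.iterate_one_divMon]
  by_cases hb : b ≤ d
  · simp [hb, h.iterate_zero_divMon]
  · simp [hb]

variable {ev : A →ₐ[ℂ] ℂ}

lemma eval_divMon (hv : ∀ j, ev (v j) = 0) (c d : ℕ) :
    ev (divMon v c d) = if c = 0 ∧ d = 0 then 1 else 0 := by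
  rcases c with _ | c <;> rcases d with _ | d <;> simp [divMon, divPow, hv]

/-- The dual pairing of divided monomials with iterated derivatives at the origin. -/
lemma IsDual.eval_iterate_divMon (h : IsDual D v) (hv : ∀ j, ev (v j) = 0) (a b c d : ℕ) :
    ev (((D 0)^[a]) (((D 1)^[b]) (divMon v c d))) = if a = c ∧ b = d then 1 else 0 := by
  rw [h.iterate_divMon]
  by_cases hab : a ≤ c ∧ b ≤ d
  · rw [if_pos hab, eval_divMon hv]
    congr 1
    apply propext
    omega
  · rw [if_neg hab, map_zero, if_neg (by omega)]

/-- At the origin, the only term of the Leibniz rule that survives is the one in which the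
divided monomial is differentiated completely. -/
lemma IsDual.eval_iterate_divMon_mul (h : IsDual D v) (hv : ∀ j, ev (v j) = 0)
    (a b c d : ℕ) (f : A) :
    ev (((D 0)^[a]) (((D 1)^[b]) (divMon v c d * f)))
      = (a.choose c : ℂ) * (b.choose d : ℂ) * ev (((D 0)^[a - c]) (((D 1)^[b - d]) f)) := by
  induction b generalizing d f with
  | zero =>
    rcases d with _ | d
    · simp only [Function.iterate_zero, id]
      induction a generalizing c f with
      | zero =>
        rcases c with _ | c
        · simp [eval_divMon hv]
        · simp [eval_divMon hv]
      | succ a ih =>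
        rw [Function.iterate_succ_apply, (D 0).leibniz, smul_eq_mul, smul_eq_mul, h.zero_divMon,
          iterate_map_add, map_add, ih]
        rcases c with _ | c
        · simp
        · rw [if_pos (by omega), mul_comm f, ih]
          by_cases hc : c + 1 ≤ a
          · have e : a - c = (a - (c + 1)) + 1 := by omega
            simp only [Nat.add_sub_cancel, Nat.add_sub_add_right, e, Function.iterate_succ_apply,
              Nat.choose_succ_succ, Nat.sub_zero, Function.iterate_zero, id, Nat.succ_eq_add_one]
            push_cast
            ring
          · rw [Nat.choose_eq_zero_of_lt (by omega : a < c + 1), Nat.choose_succ_succ,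
              Nat.choose_eq_zero_of_lt (by omega : a < c + 1)]
            simp
    · have h0 : ∀ (a c : ℕ) (f : A), ev (((D 0)^[a]) (divMon v c (d + 1) * f)) = 0 := by
        intro a
        induction a with
        | zero => intro c f; simp [eval_divMon hv]
        | succ a ih =>
          intro c f
          rw [Function.iterate_succ_apply, (D 0).leibniz, smul_eq_mul, smul_eq_mul, h.zero_divMon,
            iterate_map_add, map_add, ih]
          split_ifs
          · rw [mul_comm f, ih, add_zero]
          · simp
      simp [h0]
  | succ b ih =>
    rw [Function.iterate_succ_apply, (D 1).leibniz, smul_eq_mul, smul_eq_mul, h.one_divMon,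
      iterate_map_add, iterate_map_add, map_add, ih]
    rcases d with _ | d
    · simp
    · rw [if_pos (by omega), mul_comm f, ih]
      by_cases hc : d + 1 ≤ b
      · have e : b - d = (b - (d + 1)) + 1 := by omega
        simp only [Nat.add_sub_cancel, Nat.add_sub_add_right, e, Function.iterate_succ_apply,
          Nat.choose_succ_succ]
        push_cast
        ring
      · rw [Nat.choose_eq_zero_of_lt (by omega : b < d + 1), Nat.choose_succ_succ,
          Nat.choose_eq_zero_of_lt (by omega : b < d + 1)]
        simp

end DividedPowers

/-! ### Bidifferential expansions evaluated on divided monomials -/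

section Expansion

variable {A : Type*} [CommRing A] [Algebra ℂ A]

/-- `∑_{n < N} ∑_{i, j} t^n_{ij} (D₀^{n-i} D₁^i f) (D̄₀^{n-j} D̄₁^j g)`. -/
noncomputable def expansion (N : ℕ) (t : ∀ n : ℕ, Fin (n + 1) → Fin (n + 1) → A)
    (D Db : Fin 2 → Derivation ℂ A A) (f g : A) : A :=
  ∑ n ∈ Finset.range N, ∑ i : Fin (n + 1), ∑ j : Fin (n + 1),
    t n i j * ((D 0)^[n - i]) (((D 1)^[i]) f) * ((Db 0)^[n - j]) (((Db 1)^[j]) g)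

variable {N : ℕ} {t : ∀ n : ℕ, Fin (n + 1) → Fin (n + 1) → A}
  {D Db : Fin 2 → Derivation ℂ A A} {u v : Fin 2 → A} {ev : A →ₐ[ℂ] ℂ}

/-- At the origin, a divided monomial of degree `n` as the first argument selects one row of
`t n`. -/
lemma eval_expansion_divMon (hu : IsDual D u) (hu0 : ∀ j, ev (u j) = 0) {n : ℕ} (hn : n < N)
    (i : Fin (n + 1)) (g : A) :
    ev (expansion N t D Db (divMon u (n - i) i) g)
      = ∑ j : Fin (n + 1), ev (t n i j) * ev (((Db 0)^[n - j]) (((Db 1)^[j]) g)) := by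
  have hz : ∀ n' : ℕ, ∀ i' : Fin (n' + 1), (n' ≠ n ∨ (i' : ℕ) ≠ i) →
      ∑ j : Fin (n' + 1), ev (t n' i' j) * ev (((D 0)^[n' - i']) (((D 1)^[i'])
        (divMon u (n - i) i))) * ev (((Db 0)^[n' - j]) (((Db 1)^[j]) g)) = 0 := by
    intro n' i' hne
    refine Finset.sum_eq_zero fun j _ => ?_
    rw [hu.eval_iterate_divMon hu0, if_neg (by omega)]
    simp
  simp only [expansion, map_sum, map_mul]
  rw [Finset.sum_eq_single n, Finset.sum_eq_single i]
  · refine Finset.sum_congr rfl fun j _ => ?_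
    rw [hu.eval_iterate_divMon hu0]
    simp
  · intro i' _ hi'
    exact hz n i' (Or.inr fun hh => hi' (Fin.ext hh))
  · simp
  · intro n' _ hn'
    exact Finset.sum_eq_zero fun i' _ => hz n' i' (Or.inl hn')
  · intro hh
    exact absurd (Finset.mem_range.2 hn) hh

/-- In the derivative of the expansion, for monomials of degrees `n + 1` and `n`, the derivative
has to fall on the first factor. -/
lemma eval_derivation_expansion_divMon (hu : IsDual D u) (hu0 : ∀ j, ev (u j) = 0)
    (hv : IsDual Db v) (hv0 : ∀ j, ev (v j) = 0) (d : Derivation ℂ A A) {n : ℕ} (hn : n < N)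
    (i : Fin (n + 1 + 1)) (b : Fin (n + 1)) :
    ev (d (expansion N t D Db (divMon u (n + 1 - i) i) (divMon v (n - b) b)))
      = ∑ i' : Fin (n + 1), ev (t n i' b) * ((if (i' : ℕ) = i then ev (d (u 0)) else 0)
          + (if (i' : ℕ) + 1 = i then ev (d (u 1)) else 0)) := by
  set f := divMon u (n + 1 - i) i with hf
  set g := divMon v (n - b) b with hg
  have hterm : ∀ n' : ℕ, ∀ i' j' : Fin (n' + 1),
      ev (d (t n' i' j' * ((D 0)^[n' - i']) (((D 1)^[i']) f)
        * ((Db 0)^[n' - j']) (((Db 1)^[j']) g)))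
      = if n' = n ∧ (j' : ℕ) = b then
          ev (t n' i' j') * ev (d (((D 0)^[n' - i']) (((D 1)^[i']) f))) else 0 := by
    intro n' i' j'
    have h1 := hu.eval_iterate_divMon hu0 (n' - i') i' (n + 1 - i) i
    have h2 := hv.eval_iterate_divMon hv0 (n' - j') j' (n - b) b
    have h3 := hv.iterate_divMon (n' - j') j' (n - b) b
    rw [← hf] at h1
    rw [← hg] at h2 h3
    rw [d.leibniz, d.leibniz]
    simp only [smul_eq_mul, map_add, map_mul]
    by_cases hc : n' = n ∧ (j' : ℕ) = b
    · rw [if_neg (by omega)] at h1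
      rw [if_pos (by omega)] at h2
      rw [if_pos hc, h1, h2]
      ring
    · rw [if_neg (by omega)] at h2
      rw [if_neg hc, h2]
      -- The derivative falls on `g`: if `f` is differentiated completely, then `n' = n + 1`, and
      -- `n + 1` derivatives annihilate `g`, which has degree `n`.
      by_cases hd : n' = n + 1
      · rw [if_neg (by omega)] at h3
        rw [h3]
        simp
      · rw [if_neg (by omega)] at h1
        rw [h1]
        simp
  simp only [expansion, map_sum, hterm]
  rw [Finset.sum_eq_single n]
  · refine Finset.sum_congr rfl fun i' _ => ?_
    rw [Finset.sum_eq_single b]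
    · -- What remains of `f` is a monomial of degree one, that is, `u 0` or `u 1`.
      rw [if_pos ⟨rfl, rfl⟩, hu.iterate_divMon]
      congr 1
      split_ifs with h1 h2 h3 h3 h4
      · omega
      · rw [derivation_divMon, show n + 1 - (i : ℕ) - (n - i') = 1 by omega,
          show (i : ℕ) - i' = 0 by omega]
        simp [divMon]
      · rw [derivation_divMon, show n + 1 - (i : ℕ) - (n - i') = 0 by omega,
          show (i : ℕ) - i' = 1 by omega]
        simp [divMon]
      · omega
      · omega
      · omega
      · omega
      · simp
    · intro j' _ hj'
      rw [if_neg fun hh => hj' (Fin.ext hh.2)]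
    · simp
  · intro n' _ hn'
    exact Finset.sum_eq_zero fun i' _ => Finset.sum_eq_zero fun j' _ => if_neg fun hh => hn' hh.1
  · intro hh
    exact absurd (Finset.mem_range.2 hn) hh

end Expansion

/-! ### The algebra of smooth functions on an open set and its derivations -/

lemma pd_congr_of_eqOn {V : Set C2} (hV : IsOpen V) {f g : C2 → ℂ} (h : Set.EqOn f g V) (A : CIdx) :
    Set.EqOn (pd A f) (pd A g) V := by
  intro z hz
  have : f =ᶠ[nhds z] g := Filter.eventuallyEq_of_mem (hV.mem_nhds hz) h
  rcases A with k | k <;> simp only [pd, this.fderiv_eq]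

lemma contDiffOn_pd {V : Set C2} (hV : IsOpen V) {f : C2 → ℂ} (h : ContDiffOn ℝ ∞ f V) (A : CIdx) :
    ContDiffOn ℝ ∞ (pd A f) V := by
  have h1 : ContDiffOn ℝ ∞ (fderiv ℝ f) V := h.fderiv_of_isOpen hV (by simp)
  rcases A with k | k
  · exact ((h1.clm_apply contDiffOn_const).sub
      (contDiffOn_const.mul (h1.clm_apply contDiffOn_const))).div_const 2
  · exact ((h1.clm_apply contDiffOn_const).add
      (contDiffOn_const.mul (h1.clm_apply contDiffOn_const))).div_const 2

lemma pd_const (A : CIdx) (c : ℂ) (z : C2) : pd A (fun _ => c) z = 0 := by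
  rcases A with k | k <;> simp [pd]

lemma pd_add {f g : C2 → ℂ} {z : C2} (hf : DifferentiableAt ℝ f z) (hg : DifferentiableAt ℝ g z)
    (A : CIdx) : pd A (f + g) z = pd A f z + pd A g z := by
  rcases A with k | k <;> simp only [pd, fderiv_add hf hg, add_apply] <;> ring

lemma pd_mul {f g : C2 → ℂ} {z : C2} (hf : DifferentiableAt ℝ f z) (hg : DifferentiableAt ℝ g z)
    (A : CIdx) : pd A (f * g) z = f z * pd A g z + g z * pd A f z := by
  rcases A with k | k <;>
    simp only [pd, fderiv_mul hf hg, add_apply, smul_apply,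
      smul_eq_mul] <;> ring

lemma pd_pd_comm {V : Set C2} (hV : IsOpen V) {f : C2 → ℂ} (h : ContDiffOn ℝ ∞ f V) (A B : CIdx)
    {z : C2} (hz : z ∈ V) : pd A (pd B f) z = pd B (pd A f) z := by
  have hsym : IsSymmSndFDerivAt ℝ f z :=
    (h.contDiffAt (hV.mem_nhds hz)).isSymmSndFDerivAt (by simpa using ENat.LEInfty.out)
  have h1 : DifferentiableAt ℝ (fderiv ℝ f) z :=
    ((h.fderiv_of_isOpen hV (m := ∞) (by simp)).contDiffAt (hV.mem_nhds hz)).differentiableAt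
      (by simp)
  have h2 : ∀ w : C2, DifferentiableAt ℝ (fun y => fderiv ℝ f y w) z :=
    fun w => h1.clm_apply (differentiableAt_const _)
  have h3 : ∀ w w' : C2, fderiv ℝ (fun y => fderiv ℝ f y w) z w'
      = fderiv ℝ (fderiv ℝ f) z w' w := by
    intro w w'
    rw [fderiv_clm_apply h1 (differentiableAt_const _)]
    simp
  have key : ∀ (a : ℂ) (w w' : C2),
      fderiv ℝ (fun y => (fderiv ℝ f y w + a * fderiv ℝ f y w') / 2) z
      = (2⁻¹ : ℂ) • (fderiv ℝ (fun y => fderiv ℝ f y w) z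
        + a • fderiv ℝ (fun y => fderiv ℝ f y w') z) := by
    intro a w w'
    have : (fun y => (fderiv ℝ f y w + a * fderiv ℝ f y w') / 2)
        = (2⁻¹ : ℂ) • ((fun y => fderiv ℝ f y w) + a • (fun y => fderiv ℝ f y w')) := by
      funext y
      simp only [Pi.smul_apply, Pi.add_apply, smul_eq_mul]
      ring
    rw [this, fderiv_const_smul ((h2 w).add ((h2 w').const_smul a)),
      fderiv_add (h2 w) ((h2 w').const_smul a), fderiv_const_smul (h2 w')]
  have hpd : ∀ B : CIdx, ∃ (a : ℂ) (w w' : C2), ∀ g y,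
      pd B g y = (fderiv ℝ g y w + a * fderiv ℝ g y w') / 2 := by
    rintro (k | k)
    · exact ⟨-Complex.I, Pi.single k 1, Pi.single k Complex.I, fun g y => by rw [pd]; ring⟩
    · exact ⟨Complex.I, Pi.single k 1, Pi.single k Complex.I, fun g y => by rw [pd]⟩
  obtain ⟨a, w, w', ha⟩ := hpd A
  obtain ⟨b, x, x', hb⟩ := hpd B
  rw [ha (pd B f), hb (pd A f), funext (hb f), funext (ha f), key b, key a]
  simp only [smul_apply, add_apply, h3, smul_eq_mul]
  rw [hsym.eq x w, hsym.eq x' w, hsym.eq x w', hsym.eq x' w']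
  ring

open Classical in
/-- Extension by zero of a function on `V`. -/
noncomputable def extendZero {V : Set C2} (f : V → ℂ) (z : C2) : ℂ :=
  if hz : z ∈ V then f ⟨z, hz⟩ else 0

lemma extendZero_apply {V : Set C2} (f : V → ℂ) {z : C2} (hz : z ∈ V) :
    extendZero f z = f ⟨z, hz⟩ := dif_pos hz

lemma contDiffOn_extendZero_restrict {V : Set C2} {f : C2 → ℂ} (hf : ContDiffOn ℝ ∞ f V) :
    ContDiffOn ℝ ∞ (extendZero (V.domRestrict f)) V :=
  hf.congr fun _ hz => extendZero_apply _ hz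

/-- The algebra of smooth functions on `V`. Its elements are functions on the subtype `V`, so that
identities between them need to be verified at the points of `V` only. -/
noncomputable def smoothAlg (V : Set C2) : Subalgebra ℂ (V → ℂ) where
  carrier := {f | ContDiffOn ℝ ∞ (extendZero f) V}
  mul_mem' {f g} hf hg := (ContDiffOn.mul hf hg).congr fun z hz => by
    simp only [extendZero_apply _ hz, Pi.mul_apply]
  add_mem' {f g} hf hg := (ContDiffOn.add hf hg).congr fun z hz => by
    simp only [extendZero_apply _ hz, Pi.add_apply]
  algebraMap_mem' c := contDiffOn_extendZero_restrict (f := fun _ => c) contDiffOn_const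

/-- A smooth function on `V` as a function on the coordinate space. -/
noncomputable def total {V : Set C2} (f : smoothAlg V) : C2 → ℂ := extendZero f.1

/-- The element of `smoothAlg V` given by a function that is smooth on `V`. -/
noncomputable def ofSmooth {V : Set C2} {f : C2 → ℂ} (hf : ContDiffOn ℝ ∞ f V) : smoothAlg V :=
  ⟨V.domRestrict f, contDiffOn_extendZero_restrict hf⟩

lemma contDiffOn_total {V : Set C2} (f : smoothAlg V) : ContDiffOn ℝ ∞ (total f) V := f.2

lemma total_ofSmooth {V : Set C2} {f : C2 → ℂ} (hf : ContDiffOn ℝ ∞ f V) {z : C2} (hz : z ∈ V) :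
    total (ofSmooth hf) z = f z := extendZero_apply _ hz

lemma smoothAlg_ext {V : Set C2} {f g : smoothAlg V} (h : ∀ z ∈ V, total f z = total g z) :
    f = g := by
  refine Subtype.ext (funext fun z => ?_)
  have := h z.1 z.2
  rwa [total, total, extendZero_apply _ z.2, extendZero_apply _ z.2] at this

/-- Evaluation at a point of `V`, as a homomorphism of algebras. -/
noncomputable def evalAt {V : Set C2} {z : C2} (hz : z ∈ V) : smoothAlg V →ₐ[ℂ] ℂ :=
  (Pi.evalAlgHom ℂ (fun _ : V => ℂ) ⟨z, hz⟩).comp (smoothAlg V).val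

lemma total_eq_evalAt {V : Set C2} {z : C2} (hz : z ∈ V) (f : smoothAlg V) :
    total f z = evalAt hz f := extendZero_apply _ hz

lemma differentiableAt_total {V : Set C2} (hV : IsOpen V) (f : smoothAlg V) {z : C2}
    (hz : z ∈ V) : DifferentiableAt ℝ (total f) z :=
  ((contDiffOn_total f).contDiffAt (hV.mem_nhds hz)).differentiableAt (by simp)

/-- `∂_A` as a derivation of `smoothAlg V`. -/
noncomputable def pdDer {V : Set C2} (hV : IsOpen V) (A : CIdx) :
    Derivation ℂ (smoothAlg V) (smoothAlg V) where
  toFun f := ofSmooth (contDiffOn_pd hV (contDiffOn_total f) A)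
  map_add' f g := smoothAlg_ext fun z hz => by
    have h : Set.EqOn (total (f + g)) (total f + total g) V := fun w hw => by
      simp only [total_eq_evalAt hw, Pi.add_apply, map_add]
    rw [total_ofSmooth _ hz, pd_congr_of_eqOn hV h A hz,
      pd_add (differentiableAt_total hV f hz) (differentiableAt_total hV g hz),
      total_eq_evalAt hz, map_add, ← total_eq_evalAt, ← total_eq_evalAt, total_ofSmooth _ hz,
      total_ofSmooth _ hz]
  map_smul' c f := smoothAlg_ext fun z hz => by
    have h : Set.EqOn (total (c • f)) ((fun _ => c) * total f) V := fun w hw => by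
      simp only [total_eq_evalAt hw, Pi.mul_apply, map_smul, smul_eq_mul]
    rw [total_ofSmooth _ hz, pd_congr_of_eqOn hV h A hz,
      pd_mul (differentiableAt_const c) (differentiableAt_total hV f hz), pd_const,
      RingHom.id_apply, total_eq_evalAt hz (_ • _), map_smul, ← total_eq_evalAt,
      total_ofSmooth _ hz, smul_eq_mul, mul_zero, add_zero]
  map_one_eq_zero' := smoothAlg_ext fun z hz => by
    have h : Set.EqOn (total (1 : smoothAlg V)) (fun _ => 1) V := fun w hw => by
      rw [total_eq_evalAt hw, map_one]
    change total (ofSmooth (contDiffOn_pd hV (contDiffOn_total (1 : smoothAlg V)) A)) z = _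
    rw [total_ofSmooth _ hz, pd_congr_of_eqOn hV h A hz, pd_const, total_eq_evalAt hz, map_zero]
  leibniz' f g := smoothAlg_ext fun z hz => by
    have h : Set.EqOn (total (f * g)) (total f * total g) V := fun w hw => by
      simp only [total_eq_evalAt hw, Pi.mul_apply, map_mul]
    change total (ofSmooth (contDiffOn_pd hV (contDiffOn_total (f * g)) A)) z
      = total (f * ofSmooth (contDiffOn_pd hV (contDiffOn_total g) A)
        + g * ofSmooth (contDiffOn_pd hV (contDiffOn_total f) A)) z
    rw [total_ofSmooth _ hz, pd_congr_of_eqOn hV h A hz,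
      pd_mul (differentiableAt_total hV f hz) (differentiableAt_total hV g hz),
      total_eq_evalAt hz (_ + _), map_add, map_mul, map_mul]
    simp only [← total_eq_evalAt, total_ofSmooth _ hz]

lemma total_pdDer {V : Set C2} (hV : IsOpen V) (A : CIdx) (f : smoothAlg V) {z : C2} (hz : z ∈ V) :
    total (pdDer hV A f) z = pd A (total f) z :=
  total_ofSmooth (contDiffOn_pd hV (contDiffOn_total f) A) hz

/-- `∂_A` of a function that agrees on `V` with an element of the algebra. -/
lemma pd_eq_total_pdDer {V : Set C2} (hV : IsOpen V) (A : CIdx) {f : C2 → ℂ} {F : smoothAlg V}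
    (h : Set.EqOn f (total F) V) : Set.EqOn (pd A f) (total (pdDer hV A F)) V := fun z hz => by
  rw [total_pdDer hV A F hz, pd_congr_of_eqOn hV h A hz]

lemma pdDer_comm {V : Set C2} (hV : IsOpen V) (A B : CIdx) (f : smoothAlg V) :
    pdDer hV A (pdDer hV B f) = pdDer hV B (pdDer hV A f) := smoothAlg_ext fun z hz => by
  rw [total_pdDer _ _ _ hz, total_pdDer _ _ _ hz,
    pd_congr_of_eqOn hV (fun w hw => total_pdDer hV B f hw) A hz,
    pd_congr_of_eqOn hV (fun w hw => total_pdDer hV A f hw) B hz,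
    pd_pd_comm hV (contDiffOn_total f) A B hz]

/-! ### Kähler geometry in an algebra with four commuting derivations -/

section KahlerAlgebra

variable {A : Type*} [CommRing A] [Algebra ℂ A]

/-- `D^k = g^{k l̄} ∂_l̄`, where `H k l = g^{k̄ l}`, so that `g^{k l̄} = H l k`. -/
noncomputable def raise (δ : CIdx → Derivation ℂ A A) (H : Matrix (Fin 2) (Fin 2) A)
    (k : Fin 2) : Derivation ℂ A A :=
  ∑ l : Fin 2, H l k • δ (Sum.inr l)

/-- `D^k̄ = g^{k̄ l} ∂_l`, where `H k l = g^{k̄ l}`. -/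
noncomputable def raiseBar (δ : CIdx → Derivation ℂ A A) (H : Matrix (Fin 2) (Fin 2) A)
    (k : Fin 2) : Derivation ℂ A A :=
  ∑ l : Fin 2, H k l • δ (Sum.inl l)

/-- The Christoffel symbol `Γ^e_{pq} = g^{e s̄} ∂_p g_{q s̄}`. -/
noncomputable def chris (δ : CIdx → Derivation ℂ A A) (G H : Matrix (Fin 2) (Fin 2) A)
    (e p q : Fin 2) : A :=
  ∑ s : Fin 2, H s e * δ (Sum.inl p) (G q s)

variable {δ : CIdx → Derivation ℂ A A} {Φ : A} {G H : Matrix (Fin 2) (Fin 2) A}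

lemma raise_apply (k : Fin 2) (f : A) : raise δ H k f = ∑ l : Fin 2, H l k * δ (Sum.inr l) f := by
  simp [raise, Fin.sum_univ_two]

lemma raiseBar_apply (k : Fin 2) (f : A) :
    raiseBar δ H k f = ∑ l : Fin 2, H k l * δ (Sum.inl l) f := by
  simp [raiseBar, Fin.sum_univ_two]

lemma isDual_raise (hcomm : ∀ X Y f, δ X (δ Y f) = δ Y (δ X f))
    (hG : ∀ k l, G k l = δ (Sum.inl k) (δ (Sum.inr l) Φ)) (hGH : G * H = 1) (c : Fin 2 → ℂ) :
    IsDual (raise δ H) (fun m => δ (Sum.inl m) Φ - algebraMap ℂ A (c m)) := by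
  intro i j
  have h1 := congrFun (congrFun hGH j) i
  rw [Matrix.mul_apply, Matrix.one_apply] at h1
  rw [raise_apply]
  simp only [map_sub, Derivation.map_algebraMap, sub_zero]
  simp only [hcomm (Sum.inr _) (Sum.inl _), ← hG]
  simp only [mul_comm (H _ _), h1, eq_comm]

lemma isDual_raiseBar
    (hG : ∀ k l, G k l = δ (Sum.inl k) (δ (Sum.inr l) Φ)) (hHG : H * G = 1) (c : Fin 2 → ℂ) :
    IsDual (raiseBar δ H) (fun m => δ (Sum.inr m) Φ - algebraMap ℂ A (c m)) := by
  intro i j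
  have h1 := congrFun (congrFun hHG i) j
  rw [Matrix.mul_apply, Matrix.one_apply] at h1
  rw [raiseBar_apply]
  simp only [map_sub, Derivation.map_algebraMap, sub_zero, ← hG]
  exact h1

/-- Differentiation of the inverse metric: `∂_p g^{l̄ e} = -g^{l̄ q} Γ^e_{pq}`. -/
lemma derivation_inv_metric (hHG : H * G = 1) (hGH : G * H = 1) (p l e : Fin 2) :
    δ (Sum.inl p) (H l e) = - ∑ q : Fin 2, H l q * chris δ G H e p q := by
  have h1 : ∀ s,
      ∑ q : Fin 2, (H l q * δ (Sum.inl p) (G q s) + G q s * δ (Sum.inl p) (H l q)) = 0 := by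
    intro s
    have := congrArg (δ (Sum.inl p)) (congrFun (congrFun hHG l) s)
    rw [Matrix.mul_apply, Matrix.one_apply, map_sum] at this
    simp only [Derivation.leibniz, smul_eq_mul] at this
    rw [this]
    split_ifs <;> simp
  have h2 : ∀ q, ∑ s : Fin 2, G q s * H s e = if q = e then 1 else 0 := by
    intro q
    have := congrFun (congrFun hGH q) e
    rwa [Matrix.mul_apply, Matrix.one_apply] at this
  have h3 : δ (Sum.inl p) (H l e)
      = ∑ q : Fin 2, (if q = e then 1 else 0) * δ (Sum.inl p) (H l q) := by simp
  rw [h3]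
  simp only [← h2]
  have h10 := h1 0
  have h11 := h1 1
  simp only [Fin.sum_univ_two, chris] at h10 h11 ⊢
  linear_combination H 0 e * h10 + H 1 e * h11

/-- The curvature is the second covariant derivative of `∂_ī ∂_c̄ Φ`:
`g^{k̄ p} g^{l̄ q} R_{ī p q c̄} = D^k̄ D^l̄ ∂_ī ∂_c̄ Φ`. -/
lemma raiseBar_raiseBar_potential (hcomm : ∀ X Y f, δ X (δ Y f) = δ Y (δ X f))
    (hG : ∀ k l, G k l = δ (Sum.inl k) (δ (Sum.inr l) Φ)) (hHG : H * G = 1) (hGH : G * H = 1)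
    (i k l c : Fin 2) :
    raiseBar δ H k (raiseBar δ H l (δ (Sum.inr i) (δ (Sum.inr c) Φ)))
      = ∑ p : Fin 2, ∑ q : Fin 2, H k p * H l q *
          ∑ e : Fin 2, G e c * δ (Sum.inr i) (chris δ G H e p q) := by
  set ψ := δ (Sum.inr i) (δ (Sum.inr c) Φ) with hψ
  have h0 : ∀ e, δ (Sum.inr i) (G e c) = δ (Sum.inl e) ψ := fun e => by
    rw [hG, hcomm]
  have h1 : ∀ p q, ∑ e : Fin 2, G e c * chris δ G H e p q = δ (Sum.inl p) (G q c) := by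
    intro p q
    have h2 : ∀ s, ∑ e : Fin 2, H s e * G e c = if s = c then 1 else 0 := by
      intro s
      have := congrFun (congrFun hHG s) c
      rwa [Matrix.mul_apply, Matrix.one_apply] at this
    have h3 : δ (Sum.inl p) (G q c)
        = ∑ s : Fin 2, (if s = c then 1 else 0) * δ (Sum.inl p) (G q s) := by simp
    rw [h3]
    simp only [← h2, chris, Fin.sum_univ_two]
    ring
  have h4 : ∀ p q, ∑ e : Fin 2, G e c * δ (Sum.inr i) (chris δ G H e p q)
      = δ (Sum.inl p) (δ (Sum.inl q) ψ)
        - ∑ e : Fin 2, δ (Sum.inl e) ψ * chris δ G H e p q := by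
    intro p q
    have := congrArg (δ (Sum.inr i)) (h1 p q)
    rw [map_sum, hcomm, h0] at this
    simp only [Derivation.leibniz, smul_eq_mul, h0, Finset.sum_add_distrib] at this
    rw [← this]
    simp only [mul_comm]
    ring
  rw [raiseBar_apply]
  simp only [raiseBar_apply, h4, Fin.sum_univ_two, map_add, Derivation.leibniz, smul_eq_mul,
    derivation_inv_metric hHG hGH]
  ring

lemma chris_symm (hcomm : ∀ X Y f, δ X (δ Y f) = δ Y (δ X f))
    (hG : ∀ k l, G k l = δ (Sum.inl k) (δ (Sum.inr l) Φ)) (e p q : Fin 2) :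
    chris δ G H e p q = chris δ G H e q p := by
  simp only [chris, hG]
  simp only [hcomm (Sum.inl p) (Sum.inl q)]

end KahlerAlgebra

/-! ### Comparison with the coordinate expressions -/

section Transfer

variable {G : C2 → Matrix (Fin 2) (Fin 2) ℂ} {V : Set C2}

lemma gUp_eq {z : C2} (hz : IsUnit (G z).det) :
    gUp G z = Matrix.fromBlocks 0 ((G z)⁻¹).transpose (G z)⁻¹ 0 := by
  rw [gUp, gLow]
  apply Matrix.inv_eq_left_inv
  rw [Matrix.fromBlocks_multiply, ← Matrix.transpose_mul, Matrix.mul_nonsing_inv _ hz,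
    Matrix.nonsing_inv_mul _ hz]
  simp

lemma contDiffOn_metric_inv (hG : ∀ k l, ContDiffOn ℝ ∞ (fun z => G z k l) V)
    (hdet : ∀ z ∈ V, IsUnit (G z).det) (k l : Fin 2) :
    ContDiffOn ℝ ∞ (fun z => (G z)⁻¹ k l) V := by
  have h1 : ContDiffOn ℝ ∞ (fun z => (G z).det) V := by
    simp only [Matrix.det_fin_two]
    exact ((hG 0 0).mul (hG 1 1)).sub ((hG 0 1).mul (hG 1 0))
  have h2 : ContDiffOn ℝ ∞ (fun z => ((G z).det)⁻¹) V :=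
    h1.inv fun z hz => (hdet z hz).ne_zero
  simp only [Matrix.inv_def, Ring.inverse_eq_inv', Matrix.smul_apply, smul_eq_mul,
    Matrix.adjugate_fin_two]
  refine h2.mul ?_
  fin_cases k <;> fin_cases l <;> simp <;> first | exact hG _ _ | exact (hG _ _).neg

/-- A Kähler metric with a potential on an open set, as data in the algebra of smooth functions:
`metric k l` is `g_{k l̄}` and `inv k l` is `g^{k̄ l}`. -/
structure LocalKahler (G : C2 → Matrix (Fin 2) (Fin 2) ℂ) (V : Set C2) where
  isOpen : IsOpen V
  isUnit_det : ∀ z ∈ V, IsUnit (G z).det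
  potential : smoothAlg V
  metric : Matrix (Fin 2) (Fin 2) (smoothAlg V)
  inv : Matrix (Fin 2) (Fin 2) (smoothAlg V)
  metric_eq : ∀ k l, metric k l
    = pdDer isOpen (Sum.inl k) (pdDer isOpen (Sum.inr l) potential)
  metric_apply : ∀ k l, Set.EqOn (fun z => G z k l) (total (metric k l)) V
  inv_apply : ∀ k l, Set.EqOn (fun z => (G z)⁻¹ k l) (total (inv k l)) V
  inv_mul : inv * metric = 1
  mul_inv : metric * inv = 1

lemma total_matrix_mul (A B : Matrix (Fin 2) (Fin 2) (smoothAlg V)) (k l : Fin 2) {z : C2}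
    (hz : z ∈ V) : total ((A * B) k l) z
      = (Matrix.of (fun i j => total (A i j) z) * Matrix.of (fun i j => total (B i j) z)) k l := by
  simp only [Matrix.mul_apply, total_eq_evalAt hz, map_sum, map_mul, Matrix.of_apply]

lemma total_matrix_one (k l : Fin 2) {z : C2} (hz : z ∈ V) :
    total ((1 : Matrix (Fin 2) (Fin 2) (smoothAlg V)) k l) z
      = (1 : Matrix (Fin 2) (Fin 2) ℂ) k l := by
  simp only [Matrix.one_apply, total_eq_evalAt hz]
  split_ifs <;> simp

lemma exists_localKahler (hV : IsOpen V) {Φ : C2 → ℝ} (hΦ : IsKahlerPotential G V Φ)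
    (hdet : ∀ z ∈ V, IsUnit (G z).det) :
    ∃ K : LocalKahler G V, Set.EqOn (fun w => (Φ w : ℂ)) (total K.potential) V := by
  have hΦs : ContDiffOn ℝ ∞ (fun w => (Φ w : ℂ)) V :=
    Complex.ofRealCLM.contDiff.comp_contDiffOn hΦ.1
  have hpot : Set.EqOn (fun w => (Φ w : ℂ)) (total (ofSmooth hΦs)) V :=
    fun z hz => (total_ofSmooth hΦs hz).symm
  have hG : ∀ k l, Set.EqOn (fun z => G z k l)
      (total (pdDer hV (Sum.inl k) (pdDer hV (Sum.inr l) (ofSmooth hΦs)))) V := by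
    intro k l z hz
    rw [← pd_eq_total_pdDer hV _ (pd_eq_total_pdDer hV _ hpot) hz]
    exact hΦ.2 z hz k l
  have hGs : ∀ k l, ContDiffOn ℝ ∞ (fun z => G z k l) V :=
    fun k l => (contDiffOn_total _).congr (hG k l)
  have hH := contDiffOn_metric_inv hGs hdet
  set GA : Matrix (Fin 2) (Fin 2) (smoothAlg V) := Matrix.of fun k l =>
    pdDer hV (Sum.inl k) (pdDer hV (Sum.inr l) (ofSmooth hΦs)) with hGA
  set HA : Matrix (Fin 2) (Fin 2) (smoothAlg V) := Matrix.of fun k l => ofSmooth (hH k l) with hHA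
  have hGm : ∀ z ∈ V, Matrix.of (fun i j => total (GA i j) z) = G z := fun z hz => by
    ext i j
    exact (hG i j hz).symm
  have hHm : ∀ z ∈ V, Matrix.of (fun i j => total (HA i j) z) = (G z)⁻¹ := fun z hz => by
    ext i j
    exact total_ofSmooth (hH i j) hz
  refine ⟨⟨hV, hdet, ofSmooth hΦs, GA, HA, fun k l => rfl, hG,
    fun k l z hz => (total_ofSmooth (hH k l) hz).symm, ?_, ?_⟩, hpot⟩
  · ext1 k l
    refine smoothAlg_ext fun z hz => ?_
    rw [total_matrix_mul _ _ _ _ hz, total_matrix_one _ _ hz, hGm z hz, hHm z hz,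
      Matrix.nonsing_inv_mul _ (hdet z hz)]
  · ext1 k l
    refine smoothAlg_ext fun z hz => ?_
    rw [total_matrix_mul _ _ _ _ hz, total_matrix_one _ _ hz, hGm z hz, hHm z hz,
      Matrix.mul_nonsing_inv _ (hdet z hz)]

namespace LocalKahler

/-- The derivations `∂_A`. -/
noncomputable abbrev der (K : LocalKahler G V) (A : CIdx) :
    Derivation ℂ (smoothAlg V) (smoothAlg V) := pdDer K.isOpen A

/-- The derivations `D^k`. -/
noncomputable abbrev up (K : LocalKahler G V) :
    Fin 2 → Derivation ℂ (smoothAlg V) (smoothAlg V) := raise K.der K.inv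

/-- The derivations `D^k̄`. -/
noncomputable abbrev upBar (K : LocalKahler G V) :
    Fin 2 → Derivation ℂ (smoothAlg V) (smoothAlg V) := raiseBar K.der K.inv

lemma der_comm (K : LocalKahler G V) (A B : CIdx) (f : smoothAlg V) :
    K.der A (K.der B f) = K.der B (K.der A f) :=
  pdDer_comm K.isOpen A B f

lemma gUp_apply (K : LocalKahler G V) {z : C2} (hz : z ∈ V) : gUp G z = Matrix.fromBlocks 0
    (Matrix.of fun k l => total (K.inv l k) z) (Matrix.of fun k l => total (K.inv k l) z) 0 := by
  rw [gUp_eq (K.isUnit_det z hz)]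
  congr 1 <;> ext k l
  · exact K.inv_apply l k hz
  · exact K.inv_apply k l hz

lemma pd_eq (K : LocalKahler G V) {f : C2 → ℂ} {F : smoothAlg V} (h : Set.EqOn f (total F) V)
    (A : CIdx) : Set.EqOn (pd A f) (total (K.der A F)) V := pd_eq_total_pdDer K.isOpen A h

lemma iterate_dUp_eq (K : LocalKahler G V) (k : Fin 2) (n : ℕ) {f : C2 → ℂ} {F : smoothAlg V}
    (h : Set.EqOn f (total F) V) : Set.EqOn ((dUp G k)^[n] f) (total ((K.up k)^[n] F)) V := by
  induction n generalizing f F with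
  | zero => exact h
  | succ n ih =>
    rw [Function.iterate_succ_apply, Function.iterate_succ_apply]
    refine ih fun z hz => ?_
    rw [dUp, raise_apply, total_eq_evalAt hz, map_sum]
    refine Finset.sum_congr rfl fun l _ => ?_
    rw [map_mul, ← total_eq_evalAt, ← total_eq_evalAt, K.pd_eq h _ hz, K.gUp_apply hz]
    rfl

lemma iterate_dUpBar_eq (K : LocalKahler G V) (k : Fin 2) (n : ℕ) {f : C2 → ℂ} {F : smoothAlg V}
    (h : Set.EqOn f (total F) V) :
    Set.EqOn ((dUpBar G k)^[n] f) (total ((K.upBar k)^[n] F)) V := by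
  induction n generalizing f F with
  | zero => exact h
  | succ n ih =>
    rw [Function.iterate_succ_apply, Function.iterate_succ_apply]
    refine ih fun z hz => ?_
    rw [dUpBar, raiseBar_apply, total_eq_evalAt hz, map_sum]
    refine Finset.sum_congr rfl fun l _ => ?_
    rw [map_mul, ← total_eq_evalAt, ← total_eq_evalAt, K.pd_eq h _ hz, K.gUp_apply hz]
    rfl

lemma pd_gLow (K : LocalKahler G V) (A B C : CIdx) {z : C2} (hz : z ∈ V) :
    pd A (fun w => gLow G w B C) z
      = total (K.der A (Matrix.fromBlocks 0 K.metric K.metric.transpose 0 B C)) z := by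
  refine K.pd_eq (fun w hw => ?_) A hz
  rcases B with k | k <;> rcases C with l | l
  · simp [gLow, total_eq_evalAt hw]
  · exact K.metric_apply k l hw
  · exact K.metric_apply l k hw
  · simp [gLow, total_eq_evalAt hw]

lemma der_metric_symm (K : LocalKahler G V) (p q s : Fin 2) :
    K.der (Sum.inl p) (K.metric q s) = K.der (Sum.inl q) (K.metric p s) := by
  rw [K.metric_eq, K.metric_eq, pdDer_comm]

lemma derBar_metric_symm (K : LocalKahler G V) (i q s : Fin 2) :
    K.der (Sum.inr i) (K.metric q s) = K.der (Sum.inr s) (K.metric q i) := by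
  rw [K.metric_eq, K.metric_eq, pdDer_comm, pdDer_comm _ _ (Sum.inl q), pdDer_comm _ (Sum.inr i)]

lemma christoffel_holomorphic (K : LocalKahler G V) (e p q : Fin 2) {z : C2} (hz : z ∈ V) :
    christoffel G (Sum.inl e) (Sum.inl p) (Sum.inl q) z
      = total (chris K.der K.metric K.inv e p q) z := by
  rw [christoffel, Fintype.sum_sum_type]
  simp only [K.pd_gLow _ _ _ hz, K.gUp_apply hz, chris]
  simp [total_eq_evalAt hz, K.der_metric_symm q p]
  ring

lemma christoffel_conj_holomorphic (K : LocalKahler G V) (e p q : Fin 2) {z : C2} (hz : z ∈ V) :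
    christoffel G (Sum.inr e) (Sum.inl p) (Sum.inl q) z = 0 := by
  rw [christoffel, Fintype.sum_sum_type]
  simp only [K.pd_gLow _ _ _ hz, K.gUp_apply hz]
  simp [total_eq_evalAt hz]

lemma christoffel_mixed (K : LocalKahler G V) (E : CIdx) (i q : Fin 2) {z : C2} (hz : z ∈ V) :
    christoffel G E (Sum.inr i) (Sum.inl q) z = 0 := by
  rw [christoffel, Fintype.sum_sum_type]
  simp only [K.pd_gLow _ _ _ hz, K.gUp_apply hz]
  rcases E with e | e
  · simp [total_eq_evalAt hz, K.derBar_metric_symm i q]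
  · simp [total_eq_evalAt hz, K.der_metric_symm q]

/-- In `R_{ī p q}{}^e` only `∂_ī Γ^e_{pq}` survives, since the mixed Christoffel symbols of a
Kähler metric vanish. -/
lemma riem_apply (K : LocalKahler G V) (i p q e : Fin 2) {z : C2} (hz : z ∈ V) :
    riem G (Sum.inr i) (Sum.inl p) (Sum.inl q) (Sum.inl e) z
      = total (K.der (Sum.inr i) (chris K.der K.metric K.inv e p q)) z := by
  have h0 : Set.EqOn (christoffel G (Sum.inl e) (Sum.inr i) (Sum.inl q))
      (total (0 : smoothAlg V)) V := fun w hw => by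
    rw [K.christoffel_mixed _ _ _ hw, total_eq_evalAt hw, map_zero]
  rw [riem, K.pd_eq (fun w hw => K.christoffel_holomorphic e p q hw) _ hz, K.pd_eq h0 _ hz,
    Fintype.sum_sum_type]
  simp [K.christoffel_mixed _ _ _ hz, K.christoffel_conj_holomorphic _ _ _ hz, total_eq_evalAt hz]

lemma curv_apply (K : LocalKahler G V) (i k l c : Fin 2) {z : C2} (hz : z ∈ V) :
    curv G z i k l c = total (∑ p : Fin 2, ∑ q : Fin 2, K.inv k p * K.inv l q *
      ∑ e : Fin 2, K.metric e c * K.der (Sum.inr i) (chris K.der K.metric K.inv e p q)) z := by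
  simp only [curv, riemLow, Fintype.sum_sum_type, K.riem_apply _ _ _ _ hz, K.gUp_apply hz]
  have hG : ∀ e, G z e c = total (K.metric e c) z := fun e => K.metric_apply e c hz
  simp [gLow, hG, total_eq_evalAt hz]

/-- The curvature coefficients are second derivatives of `∂_ī ∂_c̄ Φ`. -/
lemma curv_eq_upBar_upBar (K : LocalKahler G V) (i k l c : Fin 2) {z : C2} (hz : z ∈ V) :
    curv G z i k l c = total (K.upBar k (K.upBar l
      (K.der (Sum.inr i) (K.der (Sum.inr c) K.potential)))) z := by
  rw [K.curv_apply i k l c hz, raiseBar_raiseBar_potential K.der_comm K.metric_eq K.inv_mul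
    K.mul_inv]

lemma curv_symm_inner (K : LocalKahler G V) (i k l c : Fin 2) {z : C2} (hz : z ∈ V) :
    curv G z i k l c = curv G z i l k c := by
  rw [K.curv_apply _ _ _ _ hz, K.curv_apply _ _ _ _ hz, Finset.sum_comm]
  congr 1
  refine Finset.sum_congr rfl fun q _ => Finset.sum_congr rfl fun p _ => ?_
  rw [mul_comm (K.inv k p)]
  simp only [chris_symm K.der_comm K.metric_eq _ p q]

lemma curv_symm_outer (K : LocalKahler G V) (i k l c : Fin 2) {z : C2} (hz : z ∈ V) :
    curv G z i k l c = curv G z c k l i := by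
  rw [K.curv_eq_upBar_upBar _ _ _ _ hz, K.curv_eq_upBar_upBar _ _ _ _ hz, pdDer_comm]

end LocalKahler

end Transfer

/-! ### The entries of the pentadiagonal matrix -/

/-- The entry of `X_n` in the row with multi-index `(p, q)` and the column with multi-index
`(c, d)`, expressed through binomial coefficients and second derivatives
`κ s t k m = (D^1̄)^s (D^2̄)^t ∂_k̄ ∂_m̄ Φ`. -/
lemma matX_apply {R : Fin 2 → Fin 2 → Fin 2 → Fin 2 → ℂ} {κ : ℕ → ℕ → Fin 2 → Fin 2 → ℂ}
    (h20 : ∀ k m, κ 2 0 k m = R k 0 0 m) (h11 : ∀ k m, κ 1 1 k m = R k 1 0 m)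
    (h02 : ∀ k m, κ 0 2 k m = R k 1 1 m) (hsymm : ∀ k s t m, R k s t m = R m s t k)
    {n c d p q : ℕ} (hcd : c + d = n) (hpq : p + q = n) (i j : Fin (n + 1))
    (hi : (i : ℕ) = q) (hj : (j : ℕ) = d) :
    matX R n i j = (if q = d then (n : ℂ⟦X⟧) else 0) + PowerSeries.X * PowerSeries.C
      ((if 2 ≤ c then (p.choose (c - 2) : ℂ) * (q.choose d : ℂ) * κ (p - (c - 2)) (q - d) 0 0
          else 0)
        + (if 1 ≤ c ∧ 1 ≤ d then (p.choose (c - 1) : ℂ) * (q.choose (d - 1) : ℂ)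
            * (κ (p - (c - 1)) (q - (d - 1)) 0 1 + κ (p - (c - 1)) (q - (d - 1)) 1 0) else 0)
        + (if 2 ≤ d then (p.choose c : ℂ) * (q.choose (d - 2) : ℂ) * κ (p - c) (q - (d - 2)) 1 1
          else 0)) := by
  simp only [matX, Matrix.of_apply, hi, hj]
  have hch : ∀ x, (x + 2).choose x = (x + 2).choose 2 := fun x => Nat.choose_symm_add
  have hsub : ∀ x, x + 1 + 1 - x = 2 := fun x => by omega
  -- One case for each diagonal `q - d = -2, -1, 0, 1, 2`; outside them all binomials vanish.
  by_cases h1 : q + 1 + 2 = d + 1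
  · obtain rfl : d = q + 2 := by omega
    obtain rfl : p = c + 2 := by omega
    rw [if_pos h1, if_neg (by omega), show n + 3 - (q + 2 + 1) = c + 2 by omega,
      Nat.choose_eq_zero_of_lt (by omega : q < q + 2),
      Nat.choose_eq_zero_of_lt (by omega : q < q + 2 - 1)]
    simp [h20, hch]
    ring
  rw [if_neg h1]
  by_cases h2 : q + 1 + 1 = d + 1
  · obtain rfl : d = q + 1 := by omega
    obtain rfl : p = c + 1 := by omega
    rw [if_pos h2, if_neg (by omega), show n + 2 - (q + 1 + 1) = c + 1 by omega,
      Nat.choose_eq_zero_of_lt (by omega : q < q + 1)]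
    rcases c with _ | c <;> rcases q with _ | q <;>
      simp [h20, h11, hch, hsub, hsymm 0 _ _ 1] <;> ring
  rw [if_neg h2]
  by_cases h3 : q + 1 = d + 1
  · obtain rfl : d = q := by omega
    obtain rfl : p = c := by omega
    rw [if_pos h3, if_pos rfl, show n + 1 - (d + 1) = p by omega]
    rcases p with _ | _ | p <;> rcases d with _ | _ | d <;>
      simp [h20, h11, h02, hch, hsub, hsymm 0 _ _ 1] <;> ring
  rw [if_neg h3]
  by_cases h4 : q + 1 = d + 1 + 1
  · obtain rfl : q = d + 1 := by omega
    obtain rfl : c = p + 1 := by omega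
    rw [if_pos h4, if_neg (by omega), show n - (d + 1) = p by omega,
      Nat.choose_eq_zero_of_lt (by omega : p < p + 1)]
    rcases p with _ | p <;> rcases d with _ | d <;>
      simp [h11, h02, hch, hsub, hsymm 0 _ _ 1] <;> ring
  rw [if_neg h4]
  by_cases h5 : q + 1 = d + 1 + 2
  · obtain rfl : q = d + 2 := by omega
    obtain rfl : c = p + 2 := by omega
    rw [if_pos h5, if_neg (by omega), Nat.choose_eq_zero_of_lt (by omega : p < p + 2),
      Nat.choose_eq_zero_of_lt (by omega : p < p + 2 - 1)]
    simp [h02, hch]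
    ring
  rw [if_neg h5, if_neg (by omega)]
  rcases Nat.lt_or_ge q d with hqd | hqd
  · rw [Nat.choose_eq_zero_of_lt hqd, Nat.choose_eq_zero_of_lt (by omega : q < d - 1),
      Nat.choose_eq_zero_of_lt (by omega : q < d - 2)]
    simp
  · rw [Nat.choose_eq_zero_of_lt (by omega : p < c - 2),
      Nat.choose_eq_zero_of_lt (by omega : p < c - 1),
      Nat.choose_eq_zero_of_lt (by omega : p < c)]
    simp

/-- A lowered row index as a sum over the rows of the smaller matrix, without case distinctions on
the range of the index. -/
lemma entry_eq_sum {m : ℕ} (B : Matrix (Fin m) (Fin m) ℂ⟦X⟧) (a : ℤ) (b : Fin m) :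
    entry B a ((b : ℕ) + 1) = ∑ i : Fin m, if ((i : ℕ) : ℤ) + 1 = a then B i b else 0 := by
  rw [entry]
  split_ifs with h
  · rw [Finset.sum_eq_single ⟨(a - 1).toNat, by omega⟩]
    · rw [if_pos (by simp; omega)]
      congr 1
      apply Fin.ext
      simp
    · intro i _ hi
      rw [if_neg]
      intro h'
      apply hi
      apply Fin.ext
      simp
      omega
    · simp
  · symm
    refine Finset.sum_eq_zero fun i _ => if_neg fun h' => h ?_
    have := i.2
    have := b.2
    omega

lemma entry_eq_zero {m : ℕ} (B : Matrix (Fin m) (Fin m) ℂ⟦X⟧) (a b : ℤ)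
    (h : ¬(1 ≤ b ∧ b ≤ m)) : entry B a b = 0 := dif_neg fun h' => h h'.2

/-- The column of `A'_n` as a sum over the two ways of lowering its multi-index. -/
lemma matA_succ_apply (G : C2 → Matrix (Fin 2) (Fin 2) ℂ)
    (T : ∀ n : ℕ, C2 → Matrix (Fin (n + 1)) (Fin (n + 1)) ℂ⟦X⟧) (z : C2) (n : ℕ)
    (i j : Fin (n + 1 + 1)) (S : Fin 2 → Fin (n + 1) → ℂ⟦X⟧)
    (hS : ∀ k b, S k b = ∑ i' : Fin (n + 1), T n z i' b * PowerSeries.C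
      ((if (i' : ℕ) = i then G z 0 k else 0) + (if (i' : ℕ) + 1 = i then G z 1 k else 0))) :
    matA G T z (n + 1) i j = (if h : (j : ℕ) < n + 1 then S 0 ⟨j, h⟩ else 0)
      + (if h : 1 ≤ (j : ℕ) then S 1 ⟨j - 1, by omega⟩ else 0) := by
  have key : ∀ (k : Fin 2) (b : Fin (n + 1)),
      PowerSeries.C (G z 0 k) * entry (T n z) ((i : ℕ) + 1) ((b : ℕ) + 1)
        + PowerSeries.C (G z 1 k) * entry (T n z) ((i : ℕ) + 1 - 1) ((b : ℕ) + 1) = S k b := by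
    intro k b
    rw [hS, entry_eq_sum, entry_eq_sum, Finset.mul_sum, Finset.mul_sum, ← Finset.sum_add_distrib]
    refine Finset.sum_congr rfl fun i' _ => ?_
    have e1 : (((i' : ℕ) : ℤ) + 1 = ((i : ℕ) : ℤ) + 1) ↔ (i' : ℕ) = i := by omega
    have e2 : (((i' : ℕ) : ℤ) + 1 = ((i : ℕ) : ℤ) + 1 - 1) ↔ (i' : ℕ) + 1 = i := by omega
    simp only [e1, e2]
    split_ifs <;> simp <;> ring
  have hj := j.2
  simp only [matA, Matrix.of_apply, Fin.sum_univ_two]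
  simp only [Fin.isValue, zero_ne_one, if_false, if_true, sub_zero]
  congr 1
  · split_ifs with h
    · exact key 0 ⟨j, h⟩
    · rw [entry_eq_zero _ _ _ (by push_cast; omega), entry_eq_zero _ _ _ (by push_cast; omega)]
      simp
  · split_ifs with h
    · rw [← key 1 ⟨j - 1, by omega⟩]
      simp only [Nat.cast_sub h]
      simp
    · rw [entry_eq_zero _ _ _ (by omega), entry_eq_zero _ _ _ (by omega)]
      simp

/-! ### The Karabegov condition order by order -/

section Karabegov

variable {G : C2 → Matrix (Fin 2) (Fin 2) ℂ} {Ω V : Set C2}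
  {C : ℕ → (C2 → ℂ) → (C2 → ℂ) → C2 → ℂ}
  {T : ∀ n : ℕ, C2 → Matrix (Fin (n + 1)) (Fin (n + 1)) ℂ⟦X⟧}

/-- The coefficient of `ħ^r` in `T^n_{ij}` as a smooth function on `V`. -/
noncomputable def coeffAlg (hT : HasExpansion G Ω C T) (hVΩ : V ⊆ Ω) (r n : ℕ)
    (i j : Fin (n + 1)) : smoothAlg V :=
  ofSmooth ((hT.1 n i j r).mono hVΩ)

/-- The operators `C_r` on `V`, with arbitrarily many vanishing terms added to the expansion. -/
lemma exists_expansion (hT : HasExpansion G Ω C T) (hVΩ : V ⊆ Ω) (K : LocalKahler G V)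
    (r n : ℕ) : ∃ N, n < N ∧ ∀ (f g : C2 → ℂ) (F H : smoothAlg V), Set.EqOn f (total F) V →
      Set.EqOn g (total H) V →
      Set.EqOn (C r f g) (total (expansion N (coeffAlg hT hVΩ r) K.up K.upBar F H)) V := by
  obtain ⟨N₀, h0, hexp⟩ := hT.2 r
  refine ⟨max N₀ (n + 1), by omega, fun f g F H hf hg z hz => ?_⟩
  rw [hexp V K.isOpen hVΩ f g ((contDiffOn_total F).congr hf) ((contDiffOn_total H).congr hg) z hz,
    expansion, total_eq_evalAt hz]
  rw [← Finset.eventually_constant_sum (N := N₀) _ (le_max_left N₀ (n + 1))]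
  · simp only [map_sum, map_mul]
    refine Finset.sum_congr rfl fun n' _ => Finset.sum_congr rfl fun i _ =>
      Finset.sum_congr rfl fun j _ => ?_
    rw [K.iterate_dUp_eq 0 _ (K.iterate_dUp_eq 1 _ hf) hz,
      K.iterate_dUpBar_eq 0 _ (K.iterate_dUpBar_eq 1 _ hg) hz, coeffAlg,
      ← total_eq_evalAt hz (ofSmooth _), total_ofSmooth _ hz, total_eq_evalAt hz,
      total_eq_evalAt hz]
  · intro n' hn'
    refine Finset.sum_eq_zero fun i _ => Finset.sum_eq_zero fun j _ => ?_
    rw [h0 n' hn' i j z (hVΩ hz)]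
    simp

lemma C_zero_left (hT : HasExpansion G Ω C T) (hVΩ : V ⊆ Ω) (K : LocalKahler G V) (r : ℕ)
    {g : C2 → ℂ} (hg : ContDiffOn ℝ ∞ g V) {z : C2} (hz : z ∈ V) :
    C r (fun _ => 0) g z = 0 := by
  obtain ⟨N, -, hN⟩ := exists_expansion hT hVΩ K r 0
  have h0 : Set.EqOn (fun _ : C2 => (0 : ℂ)) (total (0 : smoothAlg V)) V := fun w hw => by
    rw [total_eq_evalAt hw, map_zero]
  rw [hN _ _ _ _ h0 (fun w hw => (total_ofSmooth hg hw).symm) hz, total_eq_evalAt hz]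
  simp [expansion]

lemma C_zero_right (hT : HasExpansion G Ω C T) (hVΩ : V ⊆ Ω) (K : LocalKahler G V) (r : ℕ)
    {f : C2 → ℂ} (hf : ContDiffOn ℝ ∞ f V) {z : C2} (hz : z ∈ V) :
    C r f (fun _ => 0) z = 0 := by
  obtain ⟨N, -, hN⟩ := exists_expansion hT hVΩ K r 0
  have h0 : Set.EqOn (fun _ : C2 => (0 : ℂ)) (total (0 : smoothAlg V)) V := fun w hw => by
    rw [total_eq_evalAt hw, map_zero]
  rw [hN _ _ _ _ (fun w hw => (total_ofSmooth hf hw).symm) h0 hz, total_eq_evalAt hz]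
  simp [expansion]

lemma coeff_lift (f : C2 → ℂ) (k : ℕ) :
    (fun w => PowerSeries.coeff k (lift f w)) = if k = 0 then f else fun _ => 0 := by
  funext w
  rw [lift, PowerSeries.coeff_C]
  split_ifs <;> rfl

lemma smoothOn_lift {f : C2 → ℂ} (hf : ContDiffOn ℝ ∞ f V) : SmoothOn V (lift f) := by
  intro k
  rw [coeff_lift]
  split_ifs
  · exact hf
  · exact contDiffOn_const

/-- The star product with a first factor that does not depend on `ħ`. -/
lemma coeff_starMul_lift (hT : HasExpansion G Ω C T) (hVΩ : V ⊆ Ω) (K : LocalKahler G V)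
    (f : C2 → ℂ) {H : C2 → ℂ⟦X⟧} (hH : SmoothOn V H) (m : ℕ) {z : C2} (hz : z ∈ V) :
    PowerSeries.coeff m (starMul C (lift f) H z) = ∑ p ∈ Finset.HasAntidiagonal.antidiagonal m,
      C p.1 f (fun w => PowerSeries.coeff p.2 (H w)) z := by
  rw [starMul, PowerSeries.coeff_mk]
  refine Finset.sum_congr rfl fun p _ => ?_
  rw [Finset.sum_eq_single (0, p.2)]
  · simp only [coeff_lift, if_true]
  · rintro ⟨a, b⟩ hab hne
    have ha : a ≠ 0 := by
      rintro rfl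
      rw [Finset.HasAntidiagonal.mem_antidiagonal] at hab
      exact hne (Prod.ext rfl (by simpa using hab))
    rw [coeff_lift, if_neg ha]
    exact C_zero_left hT hVΩ K _ (hH b) hz
  · intro h
    exact absurd (Finset.HasAntidiagonal.mem_antidiagonal.2 (zero_add _)) h

lemma coeff_starMul_lift_lift (hT : HasExpansion G Ω C T) (hVΩ : V ⊆ Ω) (K : LocalKahler G V)
    {f g : C2 → ℂ} (hf : ContDiffOn ℝ ∞ f V) (hg : ContDiffOn ℝ ∞ g V) (m : ℕ) {z : C2}
    (hz : z ∈ V) : PowerSeries.coeff m (starMul C (lift f) (lift g) z) = C m f g z := by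
  rw [coeff_starMul_lift hT hVΩ K f (smoothOn_lift hg) m hz, Finset.sum_eq_single (m, 0)]
  · simp only [coeff_lift, if_true]
  · rintro ⟨a, b⟩ hab hne
    have hb : b ≠ 0 := by
      rintro rfl
      rw [Finset.HasAntidiagonal.mem_antidiagonal] at hab
      exact hne (Prod.ext (by simpa using hab) rfl)
    rw [coeff_lift, if_neg hb]
    exact C_zero_right hT hVΩ K _ hf hz
  · intro h
    exact absurd (Finset.HasAntidiagonal.mem_antidiagonal.2 (add_zero _)) h

lemma coeff_zero_rightOp_lift (Φ : C2 → ℝ) (l : Fin 2) (g : C2 → ℂ) :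
    (fun w => PowerSeries.coeff 0 (rightOp Φ l (lift g) w))
      = fun w => pd (Sum.inr l) (fun y => (Φ y : ℂ)) w * g w := by
  funext w
  simp [rightOp, lift]

lemma coeff_succ_rightOp_lift (Φ : C2 → ℝ) (l : Fin 2) (g : C2 → ℂ) (k : ℕ) :
    (fun w => PowerSeries.coeff (k + 1) (rightOp Φ l (lift g) w))
      = if k = 0 then pd (Sum.inr l) g else fun _ => 0 := by
  funext w
  rw [rightOp, map_add, PowerSeries.coeff_succ_X_mul, PowerSeries.coeff_C_mul, pdF,
    PowerSeries.coeff_mk, coeff_lift, lift, PowerSeries.coeff_C, if_neg k.succ_ne_zero, mul_zero,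
    zero_add]
  split_ifs
  · rfl
  · exact pd_const _ 0 w

variable {Φ : C2 → ℝ} {f g : C2 → ℂ} {l : Fin 2} {z : C2}

lemma smoothOn_rightOp_lift (hV : IsOpen V) (hg : ContDiffOn ℝ ∞ g V) (hΦ : ContDiffOn ℝ ∞ Φ V)
    (l : Fin 2) : SmoothOn V (rightOp Φ l (lift g)) := by
  rintro (_ | k)
  · rw [coeff_zero_rightOp_lift]
    exact (contDiffOn_pd hV (Complex.ofRealCLM.contDiff.comp_contDiffOn hΦ) _).mul hg
  · rw [coeff_succ_rightOp_lift]
    split_ifs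
    · exact contDiffOn_pd hV hg _
    · exact contDiffOn_const

/-- The coefficient of `ħ^0` in the Karabegov condition. -/
lemma karabegov_zero (hT : HasExpansion G Ω C T) (hVΩ : V ⊆ Ω) (K : LocalKahler G V)
    (hf : ContDiffOn ℝ ∞ f V) (hg : ContDiffOn ℝ ∞ g V) (hΦ : ContDiffOn ℝ ∞ Φ V) (hz : z ∈ V)
    (hkar : starMul C (lift f) (rightOp Φ l (lift g)) z
      = rightOp Φ l (starMul C (lift f) (lift g)) z) :
    C 0 f (fun w => pd (Sum.inr l) (fun y => (Φ y : ℂ)) w * g w) z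
      = pd (Sum.inr l) (fun y => (Φ y : ℂ)) z * C 0 f g z := by
  have h := congrArg (PowerSeries.coeff 0) hkar
  rw [coeff_starMul_lift hT hVΩ K f (smoothOn_rightOp_lift K.isOpen hg hΦ l) _ hz,
    Finset.Nat.antidiagonal_zero, Finset.sum_singleton, coeff_zero_rightOp_lift] at h
  rw [h, rightOp, map_add, PowerSeries.coeff_zero_X_mul, PowerSeries.coeff_C_mul,
    coeff_starMul_lift_lift hT hVΩ K hf hg _ hz, add_zero]

/-- The coefficient of `ħ^{r+1}` in the Karabegov condition, for functions independent of `ħ`. -/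
lemma karabegov_succ (hT : HasExpansion G Ω C T) (hVΩ : V ⊆ Ω) (K : LocalKahler G V)
    (hf : ContDiffOn ℝ ∞ f V) (hg : ContDiffOn ℝ ∞ g V) (hΦ : ContDiffOn ℝ ∞ Φ V) (hz : z ∈ V)
    (hkar : starMul C (lift f) (rightOp Φ l (lift g)) z
      = rightOp Φ l (starMul C (lift f) (lift g)) z) (r : ℕ) :
    C (r + 1) f (fun w => pd (Sum.inr l) (fun y => (Φ y : ℂ)) w * g w) z
        + C r f (pd (Sum.inr l) g) z
      = pd (Sum.inr l) (fun y => (Φ y : ℂ)) z * C (r + 1) f g z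
        + pd (Sum.inr l) (C r f g) z := by
  have h := congrArg (PowerSeries.coeff (r + 1)) hkar
  rw [coeff_starMul_lift hT hVΩ K f (smoothOn_rightOp_lift K.isOpen hg hΦ l) _ hz,
    Finset.Nat.sum_antidiagonal_succ', Finset.sum_eq_single (r, 0)] at h
  · simp only [coeff_zero_rightOp_lift, coeff_succ_rightOp_lift, if_true] at h
    rw [h, rightOp, map_add, PowerSeries.coeff_succ_X_mul, PowerSeries.coeff_C_mul, pdF,
      PowerSeries.coeff_mk, coeff_starMul_lift_lift hT hVΩ K hf hg _ hz,
      pd_congr_of_eqOn K.isOpen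
        (fun w hw => coeff_starMul_lift_lift hT hVΩ K hf hg r hw) _ hz]
  · rintro ⟨a, b⟩ hab hne
    have hb : b ≠ 0 := by
      rintro rfl
      rw [Finset.HasAntidiagonal.mem_antidiagonal] at hab
      exact hne (Prod.ext (by simpa using hab) rfl)
    simp only [coeff_succ_rightOp_lift, if_neg hb]
    exact C_zero_right hT hVΩ K _ hf hz
  · intro h
    exact absurd (Finset.HasAntidiagonal.mem_antidiagonal.2 (add_zero _)) h

end Karabegov

/-! ### The recursion for the coefficients -/

section Recursion

variable {G : C2 → Matrix (Fin 2) (Fin 2) ℂ} {Ω V : Set C2}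
  {C : ℕ → (C2 → ℂ) → (C2 → ℂ) → C2 → ℂ}
  {T : ∀ n : ℕ, C2 → Matrix (Fin (n + 1)) (Fin (n + 1)) ℂ⟦X⟧} {z : C2}

namespace LocalKahler

/-- The functions `∂_m Φ`, normalised to vanish at `z`. -/
noncomputable def dualCoord (K : LocalKahler G V) (hz : z ∈ V) (m : Fin 2) : smoothAlg V :=
  K.der (Sum.inl m) K.potential
    - algebraMap ℂ _ (evalAt hz (K.der (Sum.inl m) K.potential))

/-- The functions `∂_m̄ Φ`, normalised to vanish at `z`. -/
noncomputable def dualCoordBar (K : LocalKahler G V) (hz : z ∈ V) (m : Fin 2) : smoothAlg V :=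
  K.der (Sum.inr m) K.potential
    - algebraMap ℂ _ (evalAt hz (K.der (Sum.inr m) K.potential))

lemma isDual_dualCoord (K : LocalKahler G V) (hz : z ∈ V) : IsDual K.up (K.dualCoord hz) :=
  isDual_raise K.der_comm K.metric_eq K.mul_inv _

lemma isDual_dualCoordBar (K : LocalKahler G V) (hz : z ∈ V) :
    IsDual K.upBar (K.dualCoordBar hz) :=
  isDual_raiseBar K.metric_eq K.inv_mul _

lemma eval_dualCoord (K : LocalKahler G V) (hz : z ∈ V) (m : Fin 2) :
    evalAt hz (K.dualCoord hz m) = 0 := by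
  rw [dualCoord, map_sub, AlgHom.commutes]
  exact sub_self _

lemma eval_dualCoordBar (K : LocalKahler G V) (hz : z ∈ V) (m : Fin 2) :
    evalAt hz (K.dualCoordBar hz m) = 0 := by
  rw [dualCoordBar, map_sub, AlgHom.commutes]
  exact sub_self _

lemma eval_derBar_dualCoord (K : LocalKahler G V) (hz : z ∈ V) (k m : Fin 2) :
    evalAt hz (K.der (Sum.inr k) (K.dualCoord hz m)) = G z m k := by
  rw [dualCoord, map_sub, Derivation.map_algebraMap, sub_zero, pdDer_comm, ← K.metric_eq,
    ← total_eq_evalAt]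
  exact (K.metric_apply m k hz).symm

/-- The values `(D^1̄)^s (D^2̄)^t ∂_k̄ ∂_m̄ Φ` at `z`. -/
noncomputable def potentialJet (K : LocalKahler G V) (hz : z ∈ V) (s t : ℕ) (k m : Fin 2) : ℂ :=
  evalAt hz (((K.upBar 0)^[s]) (((K.upBar 1)^[t])
    (K.der (Sum.inr k) (K.der (Sum.inr m) K.potential))))

/-- The derivatives at `z` of the normalised `∂_k̄ Φ` times a divided monomial. -/
lemma eval_iterate_mul_divMon (K : LocalKahler G V) (hz : z ∈ V) (p q a b : ℕ) (k : Fin 2) :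
    evalAt hz (((K.upBar 0)^[p]) (((K.upBar 1)^[q])
      (K.dualCoordBar hz k * divMon (K.dualCoordBar hz) a b)))
    = if k = 0 then (if p = a + 1 ∧ q = b then (a : ℂ) + 1 else 0)
      else (if p = a ∧ q = b + 1 then (b : ℂ) + 1 else 0) := by
  have hv := K.isDual_dualCoordBar hz
  have hv0 := K.eval_dualCoordBar hz
  fin_cases k
  · simp only [Fin.zero_eta, mul_divMon_zero, iterate_derivation_smul, map_smul,
      hv.eval_iterate_divMon hv0, if_true]
    simp
  · simp only [Fin.mk_one, mul_divMon_one, iterate_derivation_smul, map_smul,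
      hv.eval_iterate_divMon hv0]
    simp

/-- The derivatives at `z` of `∂_k̄` of a divided monomial. -/
lemma eval_iterate_derBar_divMon (K : LocalKahler G V) (hz : z ∈ V) (p q a b : ℕ) (k : Fin 2) :
    evalAt hz (((K.upBar 0)^[p]) (((K.upBar 1)^[q])
      (K.der (Sum.inr k) (divMon (K.dualCoordBar hz) a b))))
    = (if 1 ≤ a then (p.choose (a - 1) : ℂ) * (q.choose b : ℂ)
          * K.potentialJet hz (p - (a - 1)) (q - b) k 0 else 0)
      + (if 1 ≤ b then (p.choose a : ℂ) * (q.choose (b - 1) : ℂ)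
          * K.potentialJet hz (p - a) (q - (b - 1)) k 1 else 0) := by
  have hv := K.isDual_dualCoordBar hz
  have hv0 := K.eval_dualCoordBar hz
  have hd : ∀ m, K.der (Sum.inr k) (K.dualCoordBar hz m)
      = K.der (Sum.inr k) (K.der (Sum.inr m) K.potential) := fun m => by
    rw [dualCoordBar, map_sub, Derivation.map_algebraMap, sub_zero]
  rw [derivation_divMon, iterate_map_add, iterate_map_add, map_add, hd, hd]
  congr 1
  · split_ifs
    · exact hv.eval_iterate_divMon_mul hv0 _ _ _ _ _
    · simp
  · split_ifs
    · exact hv.eval_iterate_divMon_mul hv0 _ _ _ _ _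
    · simp

end LocalKahler

variable {Φ : C2 → ℝ}

/-- The Karabegov condition, evaluated on divided monomials of degrees `n + 1` and `n` in the
functions `∂_m Φ` and `∂_m̄ Φ`. -/
lemma coeff_recursion (hT : HasExpansion G Ω C T) (hVΩ : V ⊆ Ω) (K : LocalKahler G V)
    (hz : z ∈ V) (hΦ : ContDiffOn ℝ ∞ Φ V)
    (hKΦ : Set.EqOn (fun w => (Φ w : ℂ)) (total K.potential) V)
    (hkar : ∀ f g : C2 → ℂ, ContDiffOn ℝ ∞ f V → ContDiffOn ℝ ∞ g V → ∀ l : Fin 2,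
      starMul C (lift f) (rightOp Φ l (lift g)) z = rightOp Φ l (starMul C (lift f) (lift g)) z)
    (n : ℕ) (i : Fin (n + 1 + 1)) (b : Fin (n + 1)) (k : Fin 2) :
    ∑ j : Fin (n + 1 + 1), T (n + 1) z i j *
      (PowerSeries.C (evalAt hz (((K.upBar 0)^[n + 1 - j]) (((K.upBar 1)^[j])
          (K.dualCoordBar hz k * divMon (K.dualCoordBar hz) (n - b) b))))
        + PowerSeries.X * PowerSeries.C (evalAt hz (((K.upBar 0)^[n + 1 - j]) (((K.upBar 1)^[j])
          (K.der (Sum.inr k) (divMon (K.dualCoordBar hz) (n - b) b))))))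
    = PowerSeries.X * ∑ i' : Fin (n + 1), T n z i' b * PowerSeries.C
      ((if (i' : ℕ) = i then G z 0 k else 0) + (if (i' : ℕ) + 1 = i then G z 1 k else 0)) := by
  set F := divMon (K.dualCoord hz) (n + 1 - i) i with hF
  set g := divMon (K.dualCoordBar hz) (n - b) b with hg
  set φ := K.der (Sum.inr k) K.potential with hφ
  have hu := K.isDual_dualCoord hz
  have hu0 := K.eval_dualCoord hz
  have hv := K.isDual_dualCoordBar hz
  have hv0 := K.eval_dualCoordBar hz
  -- `C_r(F, ·)` at `z` involves only the row `i` of `T^{n+1}`.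
  have hC : ∀ (r : ℕ) (h : C2 → ℂ) (H : smoothAlg V), Set.EqOn h (total H) V →
      C r (total F) h z = ∑ j : Fin (n + 1 + 1), PowerSeries.coeff r (T (n + 1) z i j) *
        evalAt hz (((K.upBar 0)^[n + 1 - j]) (((K.upBar 1)^[j]) H)) := by
    intro r h H hH
    obtain ⟨N, hN, hexp⟩ := exists_expansion hT hVΩ K r (n + 1)
    rw [hexp (total F) h F H (fun _ _ => rfl) hH hz, total_eq_evalAt hz,
      eval_expansion_divMon hu hu0 hN]
    refine Finset.sum_congr rfl fun j _ => ?_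
    rw [coeffAlg, ← total_eq_evalAt hz (ofSmooth _), total_ofSmooth _ hz]
  have hφg : Set.EqOn (fun w => pd (Sum.inr k) (fun y => (Φ y : ℂ)) w * total g w)
      (total (φ * g)) V := fun w hw => by
    dsimp only
    rw [K.pd_eq hKΦ _ hw, total_eq_evalAt hw, total_eq_evalAt hw, total_eq_evalAt hw, map_mul]
  have hφz : pd (Sum.inr k) (fun y => (Φ y : ℂ)) z = evalAt hz φ := by
    rw [K.pd_eq hKΦ _ hz, total_eq_evalAt hz]
  -- Passing from `∂_k̄ Φ` to its normalisation changes `φ g` by a constant multiple of `g`.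
  have hlin : ∀ s t : ℕ, evalAt hz (((K.upBar 0)^[s]) (((K.upBar 1)^[t]) (φ * g)))
      = evalAt hz (((K.upBar 0)^[s]) (((K.upBar 1)^[t]) (K.dualCoordBar hz k * g)))
        + evalAt hz φ * evalAt hz (((K.upBar 0)^[s]) (((K.upBar 1)^[t]) g)) := by
    intro s t
    have : φ * g = K.dualCoordBar hz k * g + evalAt hz φ • g := by
      rw [LocalKahler.dualCoordBar, Algebra.smul_def]
      ring
    rw [this, iterate_map_add, iterate_map_add, map_add, iterate_derivation_smul,
      iterate_derivation_smul, map_smul, smul_eq_mul]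
  have hFs := contDiffOn_total F
  have hgs := contDiffOn_total g
  have hk := hkar _ _ hFs hgs k
  ext r
  simp only [mul_add, Finset.sum_add_distrib, map_add, map_sum, Finset.mul_sum]
  rcases r with _ | r
  · have h0 := karabegov_zero hT hVΩ K hFs hgs hΦ hz hk
    rw [hC 0 _ _ hφg, hC 0 _ g (fun _ _ => rfl), hφz] at h0
    simp only [hlin, mul_add, Finset.sum_add_distrib, Finset.mul_sum] at h0
    simp only [PowerSeries.coeff_mul_C, mul_left_comm _ PowerSeries.X, PowerSeries.coeff_zero_X_mul,
      Finset.sum_const_zero, add_zero]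
    have h1 : ∀ j : Fin (n + 1 + 1), ∀ y : ℂ,
        evalAt hz φ * (PowerSeries.coeff 0 (T (n + 1) z i j) * y)
        = PowerSeries.coeff 0 (T (n + 1) z i j) * (evalAt hz φ * y) := fun j y => by ring
    simp only [h1] at h0
    exact add_eq_right.1 h0
  · have h0 := karabegov_succ hT hVΩ K hFs hgs hΦ hz hk r
    obtain ⟨N, hN, hexp⟩ := exists_expansion hT hVΩ K r n
    rw [hC (r + 1) _ _ hφg, hC (r + 1) _ g (fun _ _ => rfl), hφz,
      hC r _ _ (K.pd_eq (fun _ _ => rfl) (Sum.inr k)),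
      K.pd_eq (hexp (total F) (total g) F g (fun _ _ => rfl) (fun _ _ => rfl)) _ hz,
      total_eq_evalAt hz, eval_derivation_expansion_divMon hu hu0 hv hv0 _ hN,
      K.eval_derBar_dualCoord hz, K.eval_derBar_dualCoord hz] at h0
    simp only [hlin, mul_add, Finset.sum_add_distrib, Finset.mul_sum] at h0
    simp only [PowerSeries.coeff_mul_C, mul_left_comm _ PowerSeries.X, PowerSeries.coeff_succ_X_mul]
    have h1 : ∀ j : Fin (n + 1 + 1), ∀ y : ℂ,
        evalAt hz φ * (PowerSeries.coeff (r + 1) (T (n + 1) z i j) * y)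
        = PowerSeries.coeff (r + 1) (T (n + 1) z i j) * (evalAt hz φ * y) := fun j y => by ring
    have h2 : ∀ i' : Fin (n + 1), evalAt hz (coeffAlg hT hVΩ r n i' b)
        = PowerSeries.coeff r (T n z i' b) := fun i' => by
      rw [coeffAlg, ← total_eq_evalAt hz (ofSmooth _), total_ofSmooth _ hz]
    simp only [h1, h2] at h0
    linear_combination h0

/-- The identity of the matrices at a point near which the star product satisfies the Karabegov
condition: the columns of `X_n` collect the recursions for the two ways of lowering the
multi-index of the column. -/
lemma mul_matX_apply (hT : HasExpansion G Ω C T) (hVΩ : V ⊆ Ω) (K : LocalKahler G V)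
    (hz : z ∈ V) (hΦ : ContDiffOn ℝ ∞ Φ V)
    (hKΦ : Set.EqOn (fun w => (Φ w : ℂ)) (total K.potential) V)
    (hkar : ∀ f g : C2 → ℂ, ContDiffOn ℝ ∞ f V → ContDiffOn ℝ ∞ g V → ∀ l : Fin 2,
      starMul C (lift f) (rightOp Φ l (lift g)) z = rightOp Φ l (starMul C (lift f) (lift g)) z)
    (n : ℕ) (i j : Fin (n + 1)) :
    (T n z * matX (curv G z) n) i j = PowerSeries.X * matA G T z n i j := by
  rcases n with _ | n
  · obtain rfl := Fin.fin_one_eq_zero j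
    simp [Matrix.mul_apply, matX, matA]
  set E : Fin 2 → Fin (n + 1) → Fin (n + 1 + 1) → ℂ⟦X⟧ := fun k b j' =>
    PowerSeries.C (evalAt hz (((K.upBar 0)^[n + 1 - j']) (((K.upBar 1)^[j'])
        (K.dualCoordBar hz k * divMon (K.dualCoordBar hz) (n - b) b))))
      + PowerSeries.X * PowerSeries.C (evalAt hz (((K.upBar 0)^[n + 1 - j']) (((K.upBar 1)^[j'])
        (K.der (Sum.inr k) (divMon (K.dualCoordBar hz) (n - b) b))))) with hE
  have hrec := coeff_recursion hT hVΩ K hz hΦ hKΦ hkar n i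
  have hX : ∀ j', matX (curv G z) (n + 1) j' j = (if h : (j : ℕ) < n + 1 then E 0 ⟨j, h⟩ j' else 0)
      + (if h : 1 ≤ (j : ℕ) then E 1 ⟨j - 1, by omega⟩ j' else 0) := by
    intro j'
    have hj := j.2
    have hj' := j'.2
    rw [matX_apply (κ := K.potentialJet hz) (c := n + 1 - j) (d := j) (p := n + 1 - j') (q := j')
      _ _ _ (fun k s t m => K.curv_symm_outer k s t m hz) (by omega) (by omega) j' j rfl rfl]
    · simp only [hE, K.eval_iterate_mul_divMon, K.eval_iterate_derBar_divMon]
      generalize (j' : ℕ) = q at *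
      generalize (j : ℕ) = d at *
      generalize K.potentialJet hz = κ
      obtain ⟨p, hp⟩ : ∃ p, n + 1 - q = p := ⟨_, rfl⟩
      rw [hp]
      rcases d with _ | d
      · have hq : q = 0 ↔ p = n + 1 := by omega
        by_cases hq0 : q = 0 <;> simp [hq0, ← hq]
      · obtain ⟨c, rfl⟩ : ∃ c, n = c + d := ⟨n - d, by omega⟩
        have hq : q = d + 1 → p = c := by omega
        have e1 : c + d + 1 - (d + 1) = c := by omega
        have e2 : c + d - (d + 1) = c - 1 := by omega
        have e3 : c + d - d = c := by omega
        rcases c with _ | c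
        · by_cases hq0 : q = d + 1
          · simp [hq0, hq hq0]
          · simp [hq0]
        · simp only [e1, e2, Nat.add_sub_cancel]
          by_cases hq0 : q = d + 1
          · simp [hq0, hq hq0]
            ring
          · simp [hq0]
            ring
    · intro k m
      rw [K.curv_eq_upBar_upBar _ _ _ _ hz, total_eq_evalAt hz]
      rfl
    · intro k m
      rw [K.curv_symm_inner k 1 0 m hz, K.curv_eq_upBar_upBar _ _ _ _ hz, total_eq_evalAt hz]
      rfl
    · intro k m
      rw [K.curv_eq_upBar_upBar _ _ _ _ hz, total_eq_evalAt hz]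
      rfl
  rw [Matrix.mul_apply, matA_succ_apply G T z n i j _ (fun _ _ => rfl)]
  simp only [hX, mul_add, Finset.sum_add_distrib]
  congr 1
  · split_ifs
    · exact hrec _ 0
    · simp
  · split_ifs
    · exact hrec _ 1
    · simp

end Recursion

/-! ### Nondegeneracy of the metric in a chart -/

lemma isUnit_det_comp {M : Type*} [TopologicalSpace M] [ChartedSpace C2 M]
    [IsManifold 𝓘(ℂ, C2) ω M] (h : HermitianForm M) {φ : OpenPartialHomeomorph M C2}
    (hφ : φ ∈ IsManifold.maximalAtlas 𝓘(ℂ, C2) ω M) {z : C2} (hz : z ∈ φ.target) :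
    IsUnit (h.comp φ z).det := by
  have hd : φ.MDifferentiable 𝓘(ℂ, C2) 𝓘(ℂ, C2) :=
    ⟨(contMDiffOn_of_mem_maximalAtlas hφ).mdifferentiableOn (by simp),
      (contMDiffOn_symm_of_mem_maximalAtlas hφ).mdifferentiableOn (by simp)⟩
  have hinj : Function.Injective (mfderiv 𝓘(ℂ, C2) 𝓘(ℂ, C2) φ.symm z) :=
    hd.symm.mfderiv_injective hz
  set L := mfderiv 𝓘(ℂ, C2) 𝓘(ℂ, C2) φ.symm z with hL
  rw [isUnit_iff_ne_zero]
  intro hdet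
  obtain ⟨v, hv, hGv⟩ := Matrix.exists_mulVec_eq_zero_iff.2 hdet
  -- A null vector `v` of the Gram matrix gives a tangent vector of length zero.
  set w := starRingEnd ℂ (v 0) • L (Pi.single 0 (1 : ℂ) : C2)
    + starRingEnd ℂ (v 1) • L (Pi.single 1 (1 : ℂ) : C2) with hw
  have hw0 : w ≠ 0 := by
    have hw' : w = L (fun k => starRingEnd ℂ (v k) : C2) := by
      have hsum : (fun k => starRingEnd ℂ (v k) : C2) = starRingEnd ℂ (v 0) • (Pi.single 0 1 : C2)
          + starRingEnd ℂ (v 1) • (Pi.single 1 1 : C2) := by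
        funext k
        fin_cases k <;> simp
      have hlin : ∀ (a b : ℂ) (x y : TangentSpace 𝓘(ℂ, C2) z),
          L (a • x + b • y) = a • L x + b • L y := fun a b x y => by
        rw [map_add, map_smul, map_smul]
      rw [hw, hsum]
      exact (hlin _ _ _ _).symm
    rw [hw']
    intro h0
    apply hv
    have h1 : (fun k => starRingEnd ℂ (v k) : C2) = 0 := hinj (h0.trans (map_zero L).symm)
    funext k
    simpa using congrFun h1 k
  have hpos := h.pos (φ.symm z) w hw0
  have h0 := congrFun hGv 0
  have h1 := congrFun hGv 1
  simp only [Matrix.mulVec, dotProduct, Fin.sum_univ_two, HermitianForm.comp, Matrix.of_apply,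
    ← hL, Pi.zero_apply] at h0 h1
  have hzero : h.inner (φ.symm z) w w = 0 := by
    rw [hw]
    simp only [map_add, LinearMap.add_apply, map_smul, map_smulₛₗ, LinearMap.smul_apply,
      smul_eq_mul, Complex.conj_conj]
    linear_combination starRingEnd ℂ (v 0) * h0 + starRingEnd ℂ (v 1) * h1
  rw [hzero] at hpos
  simp at hpos

end KahlerStar

theorem mainTheorem2 {M : Type*} [TopologicalSpace M] [ChartedSpace C2 M]
    [IsManifold 𝓘(ℂ, C2) ω M]
    (h : HermitianForm M) (hK : h.IsKahler) (hS : h.IsLocallySymmetric)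
    (φ : OpenPartialHomeomorph M C2) (hφ : φ ∈ IsManifold.maximalAtlas 𝓘(ℂ, C2) ω M)
    (U : Set M) (hU : IsOpen U) (hUφ : U ⊆ φ.source)
    (C : ℕ → (C2 → ℂ) → (C2 → ℂ) → C2 → ℂ)
    (hC : IsStarProduct (h.comp φ) (φ '' U) C)
    (hsep : SeparatesVariables (φ '' U) C)
    (hKar : KarabegovCondition (h.comp φ) (φ '' U) C)
    (T : ∀ n : ℕ, C2 → Matrix (Fin (n + 1)) (Fin (n + 1)) ℂ⟦X⟧)
    (hT : HasExpansion (h.comp φ) (φ '' U) C T) :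
    ∀ (n : ℕ), ∀ p ∈ U,
      T n (φ p) * matX (curv (h.comp φ) (φ p)) n
        = (PowerSeries.X : ℂ⟦X⟧) • matA (h.comp φ) T (φ p) n := by

  intro n p hp
  have hΩ : IsOpen (φ '' U) := φ.isOpen_image_of_subset_source hU hUφ
  obtain ⟨V, hV, hzV, hVΩ, Φ, hΦ, hkar⟩ := hKar (φ p) ⟨p, hp, rfl⟩
  have hVt : V ⊆ φ.target := fun z hz => by
    obtain ⟨x, hx, rfl⟩ := hVΩ hz
    exact φ.map_source (hUφ hx)
  obtain ⟨K, hK'⟩ := exists_localKahler hV hΦ fun z hz => isUnit_det_comp h hφ (hVt hz)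
  ext1 i j
  rw [Matrix.smul_apply, smul_eq_mul]
  exact mul_matX_apply hT hVΩ K hzV hΦ.1 hK' (fun f g hf hg l =>
    hkar V hV subset_rfl _ _ (smoothOn_lift hf) (smoothOn_lift hg) l _ hzV) n i j
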